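/- Let $N\ge 2$, let $\mathbb Z_N=\{0,\dots,N-1\}$ and let $\mathcal K_N=\mathbb Z_N^{\mathbb N}$ be the space of infinite words $x_1x_2\dots$ with its Borel $\sigma$-algebra, with shift $\sigma(x_1x_2x_3\dots)=x_2x_3\dots$. Let $\lambda=(\lambda_i)_{i\in\mathbb Z_N}$ be a probability vector with positive entries and let $T^{(1)},T^{(2)},\dots$ be stochastic $N\times N$ matrices with positive entries such that $\lambda T^{(1)}=\lambda$. The Markov measure $\mu$ associated to $(\lambda,T)$ is the Borel probability measure on $\mathcal K_N$ that satisfies $$\mu(\{x: x_1=i_1,\dots,x_n=i_n\})=\lambda_{i_1}T^{(1)}_{i_1,i_2}\cdots T^{(n-1)}_{i_{n-1},i_n}$$ for all finite words $i_1\dots i_n$. It is called quasi-stationary if $$\sum_{n=1}^\infty\left|\frac{T^{(n)}_{x_n,x_{n+1}}}{T^{(n+1)}_{x_n,x_{n+1}}}-1\right|<\infty\quad\text{for all }x_1x_2\dots\in\mathcal K_N .$$ In that case, put $F(x_1x_2\dots)=\prod_{n=1}^\infty T^{(n)}_{x_n,x_{n+1}}/T^{(n+1)}_{x_n,x_{n+1}}$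 and $$f_j(x_1x_2\dots)=\delta_{j,x_1}\sqrt{\frac{\lambda_{x_2}}{\lambda_{x_1}T^{(1)}_{x_1,x_2}}F(x_2x_3\dots)}\qquad(j\in\mathbb Z_N).$$ The operators $S_jf=f_j\cdot(f\circ\sigma)$ on the complex Hilbert space $L^2(\mu)$ satisfy the Cuntz relations $S_i^*S_j=\delta_{ij}I$, $\sum_iS_iS_i^*=I$; they form the representation of the Cuntz algebra $\mathcal O_N$ associated to $(\lambda,T)$. Two representations of $\mathcal O_N$ are equivalent if they are unitarily equivalent, and disjoint if no nonzero subrepresentation of the first is unitarily equivalent to a subrepresentation of the second. Two measures are equivalent if each is absolutely continuous with respect to the other. Let $\mu$ and $\mu'$ be quasi-stationary Markov measures associated to $(\lambda,T)$ and $(\lambda',T')$ respectively, with associated representations $\pi=(S_i)_{i\in\mathbb Z_N}$ and $\pi'=(S_i')_{i\in\mathbb Z_N}$ of $\mathcal O_N$. Define $Z_\infty:\mathcal K_N\to[0,\infty]$ by $$Z_\infty(x_1x_2\dots)=\frac{\lambda'_{x_1}}{\lambda_{x_1}}\limsup_{n}\prod_{k=1}^{n-1}\frac{T'^{(k)}_{x_k,x_{k+1}}}{T^{(k)}_{x_k,x_{k+1}}}.$$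 The following statements are equivalent: (i) The representations $\pi$ and $\pi'$ are equivalent. (ii) The measures $\mu$ and $\mu'$ are equivalent. (iii) $\mu'(Z_\infty<\infty)=\mu(Z_\infty>0)=1$. (iv) For $\mu$-almost every and $\mu'$-almost every $i_1i_2\dots\in\mathcal K_N$, $$\sum_{n=1}^\infty\left(1-\sum_{j\in\mathbb Z_N}\sqrt{T'^{(n)}_{i_n,j}}\sqrt{T^{(n)}_{i_n,j}}\right)<\infty .$$ Also, the following statements are equivalent: (a) The representations $\pi$ and $\pi'$ are disjoint. (b) The measures $\mu$ and $\mu'$ are mutually singular. (c) $\mu'(Z_\infty=\infty)=1$ or $\mu(Z_\infty=0)=1$. (d) For $\mu'$-almost every $i_1i_2\dots\in\mathcal K_N$, $$\sum_{n=1}^\infty\left(1-\sum_{j\in\mathbb Z_N}\sqrt{T'^{(n)}_{i_n,j}}\sqrt{T^{(n)}_{i_n,j}}\right)=\infty .$$ -/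

import Mathlib

open MeasureTheory ProbabilityTheory Filter Topology
open scoped ENNReal

namespace CuntzMarkov

/-! ### Representations of the Cuntz algebra -/

/-- A representation of the Cuntz algebra `O_N` on a Hilbert space `H`, given by the images
`S 0, …, S (N - 1)` of the generating isometries, subject to the Cuntz relations. -/
structure CuntzRep (N : ℕ) (H : Type*) [NormedAddCommGroup H] [InnerProductSpace ℂ H]
    [CompleteSpace H] where
  S : Fin N → H →L[ℂ] H
  adjoint_comp : ∀ i j, ContinuousLinearMap.adjoint (S i) ∘L S j = if i = j then 1 else 0
  sum_comp_adjoint : ∑ i, S i ∘L ContinuousLinearMap.adjoint (S i) = 1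

namespace CuntzRep

variable {N : ℕ} {H K : Type*} [NormedAddCommGroup H] [InnerProductSpace ℂ H] [CompleteSpace H]
  [NormedAddCommGroup K] [InnerProductSpace ℂ K] [CompleteSpace K]

/-- Unitary equivalence of representations. -/
def Equivalent (π : CuntzRep N H) (ρ : CuntzRep N K) : Prop :=
  ∃ U : H ≃ₗᵢ[ℂ] K, ∀ i x, U (π.S i x) = ρ.S i (U x)

/-- `M` carries a subrepresentation: it is a closed subspace that is invariant under all
operators `S i` and `(S i)*`. -/
def IsReducing (π : CuntzRep N H) (M : Submodule ℂ H) : Prop :=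
  IsClosed (M : Set H) ∧
    ∀ i, ∀ x ∈ M, π.S i x ∈ M ∧ ContinuousLinearMap.adjoint (π.S i) x ∈ M

/-- Disjointness of representations: no nonzero subrepresentation of `π` is unitarily equivalent
to a subrepresentation of `ρ`. -/
def Disjoint (π : CuntzRep N H) (ρ : CuntzRep N K) : Prop :=
  ∀ (M : Submodule ℂ H) (L : Submodule ℂ K), π.IsReducing M → ρ.IsReducing L →
    ∀ U : M ≃ₗᵢ[ℂ] L,
      (∀ (i : Fin N) (x y : M), (y : H) = π.S i x → (U y : K) = ρ.S i (U x)) → M = ⊥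

end CuntzRep

/-! ### Infinite words -/

/-- The space of infinite words over the alphabet `{0, …, N - 1}`, with its product σ-algebra
(which is the Borel σ-algebra of the product topology). The word `x₁x₂x₃…` is the function
`x` with `x 0 = x₁`, `x 1 = x₂`, and so on. -/
abbrev Words (N : ℕ) : Type := ℕ → Fin N

/-- The one-sided shift `x₁x₂x₃… ↦ x₂x₃…`. -/
def shift {N : ℕ} (x : Words N) : Words N := fun n => x (n + 1)

/-- The inverse branch `x₁x₂… ↦ j x₁x₂…` of the shift. -/
def branch {N : ℕ} (j : Fin N) (x : Words N) : Words N := fun n => Nat.casesOn n j x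

@[simp] lemma branch_zero {N : ℕ} (j : Fin N) (x : Words N) : branch j x 0 = j := rfl

@[simp] lemma branch_succ {N : ℕ} (j : Fin N) (x : Words N) (n : ℕ) :
    branch j x (n + 1) = x n := rfl

@[simp] lemma shift_branch {N : ℕ} (j : Fin N) (x : Words N) : shift (branch j x) = x := rfl

lemma branch_shift {N : ℕ} {j : Fin N} {x : Words N} (h : x 0 = j) : branch j (shift x) = x := by
  funext n
  cases n with
  | zero => exact h.symm
  | succ n => rfl

lemma measurable_shift {N : ℕ} : Measurable (shift : Words N → Words N) :=
  measurable_pi_lambda _ fun n => measurable_pi_apply (n + 1)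

lemma measurable_branch {N : ℕ} (j : Fin N) : Measurable (branch j : Words N → Words N) := by
  refine measurable_pi_lambda _ fun n => ?_
  cases n with
  | zero => exact measurable_const
  | succ n => exact measurable_pi_apply n

/-! ### Markov measures -/

/-- A positive probability vector `λ` (`init`) and a sequence of stochastic matrices
`T⁽¹⁾, T⁽²⁾, …` with positive entries such that `λ T⁽¹⁾ = λ`. Here `trans n` is `T⁽ⁿ⁺¹⁾`. -/
structure MarkovPair (N : ℕ) where
  init : Fin N → ℝ
  trans : ℕ → Matrix (Fin N) (Fin N) ℝ
  init_pos : ∀ i, 0 < init i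
  init_sum : ∑ i, init i = 1
  trans_pos : ∀ n i j, 0 < trans n i j
  trans_sum : ∀ n i, ∑ j, trans n i j = 1
  init_vecMul : Matrix.vecMul init (trans 0) = init

/-- The measure on the alphabet with weights `p 0, …, p (N - 1)`. -/
noncomputable def letterMeasure {N : ℕ} (p : Fin N → ℝ) : Measure (Fin N) :=
  ∑ j, ENNReal.ofReal (p j) • Measure.dirac j

lemma letterMeasure_singleton {N : ℕ} (p : Fin N → ℝ) (j : Fin N) :
    letterMeasure p {j} = ENNReal.ofReal (p j) := by
  classical
  simp only [letterMeasure, Measure.coe_finsetSum, Finset.sum_apply, Measure.smul_apply,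
    smul_eq_mul]
  rw [Finset.sum_eq_single j]
  · simp
  · intro b _ hb
    simp [hb]
  · simp

lemma isProbabilityMeasure_letterMeasure {N : ℕ} {p : Fin N → ℝ} (hp : ∀ j, 0 < p j)
    (hs : ∑ j, p j = 1) : IsProbabilityMeasure (letterMeasure p) := by
  constructor
  simp only [letterMeasure, Measure.coe_finsetSum, Finset.sum_apply, Measure.smul_apply,
    smul_eq_mul, measure_univ, mul_one]
  rw [← ENNReal.ofReal_sum_of_nonneg fun j _ => (hp j).le, hs, ENNReal.ofReal_one]

namespace MarkovPair

variable {N : ℕ} (D : MarkovPair N)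

/-- The transition kernel from the word `x₁…xₙ₊₁` to the next letter, with weights
`T⁽ⁿ⁺¹⁾ (xₙ₊₁, ·)`. -/
noncomputable def kernel (n : ℕ) : Kernel (∀ _ : Finset.Iic n, Fin N) (Fin N) :=
  Kernel.ofFunOfCountable fun y => letterMeasure (D.trans n (y ⟨n, Finset.mem_Iic.2 le_rfl⟩))

instance (n : ℕ) : IsMarkovKernel (D.kernel n) :=
  ⟨fun _ => isProbabilityMeasure_letterMeasure (D.trans_pos _ _) (D.trans_sum _ _)⟩

/-- The Markov measure associated to `(λ, T)`: the law of the Markov chain with initial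
distribution `λ` and transition matrices `T⁽¹⁾, T⁽²⁾, …`. -/
noncomputable def measure : Measure (Words N) :=
  Kernel.trajMeasure (X := fun _ => Fin N) (letterMeasure D.init) D.kernel

instance : IsProbabilityMeasure D.measure := by
  have := isProbabilityMeasure_letterMeasure D.init_pos D.init_sum
  unfold measure
  infer_instance

/-- The set of words that start with `y₁…yₙ₊₁`. -/
def cyl (y : Words N) (n : ℕ) : Set (Words N) := {x | ∀ k ≤ n, x k = y k}

lemma cyl_eq_preimage (y : Words N) (n : ℕ) :
    cyl y n = Preorder.frestrictLe (π := fun _ => Fin N) n ⁻¹' {Preorder.frestrictLe n y} := by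
  ext x
  simp only [cyl, Set.mem_ofPred_eq, Set.mem_preimage, Set.mem_singleton_iff]
  constructor
  · intro h
    funext k
    exact h k (Finset.mem_Iic.1 k.2)
  · intro h k hk
    exact congrFun h ⟨k, Finset.mem_Iic.2 hk⟩

lemma measurableSet_cyl (y : Words N) (n : ℕ) : MeasurableSet (cyl y n) := by
  rw [cyl_eq_preimage]
  exact Preorder.measurable_frestrictLe n (measurableSet_singleton _)

/-- The defining formula `μ(C(i₁…iₙ₊₁)) = λ(i₁) T⁽¹⁾(i₁,i₂) ⋯ T⁽ⁿ⁾(iₙ,iₙ₊₁)`. -/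
lemma measure_cyl (y : Words N) (n : ℕ) : D.measure (cyl y n) =
    ENNReal.ofReal (D.init (y 0) * ∏ k ∈ Finset.range n, D.trans k (y k) (y (k + 1))) := by
  have hp := isProbabilityMeasure_letterMeasure D.init_pos D.init_sum
  induction n with
  | zero =>
    have h1 : D.measure.map (Preorder.frestrictLe (π := fun _ => Fin N) 0) =
        (letterMeasure D.init).map (MeasurableEquiv.piUnique fun _ : Finset.Iic 0 => Fin N).symm := by
      rw [measure, Kernel.trajMeasure, Measure.map_comp _ _ (by fun_prop),
        Kernel.traj_map_frestrictLe, Kernel.partialTraj_self, Measure.id_comp]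
    rw [cyl_eq_preimage, ← Measure.map_apply (Preorder.measurable_frestrictLe 0)
      (measurableSet_singleton _), h1, Measure.map_apply (by fun_prop) (measurableSet_singleton _)]
    have h2 : (MeasurableEquiv.piUnique fun _ : Finset.Iic 0 => Fin N).symm ⁻¹'
        {Preorder.frestrictLe (π := fun _ => Fin N) 0 y} = {y 0} := by
      ext a
      simp only [Set.mem_preimage, Set.mem_singleton_iff]
      rw [MeasurableEquiv.symm_apply_eq]
      rfl
    rw [h2, letterMeasure_singleton]
    simp
  | succ n ih =>
    have h1 := Kernel.map_frestrictLe_trajMeasure_compProd_eq_map_trajMeasure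
      (X := fun _ => Fin N) (μ₀ := letterMeasure D.init) (κ := D.kernel) (a := n)
    have h2 : cyl y (n + 1) = (fun x : Words N => (Preorder.frestrictLe (π := fun _ => Fin N) n x,
        x (n + 1))) ⁻¹' ({Preorder.frestrictLe n y} ×ˢ {y (n + 1)}) := by
      ext x
      change _ ↔ x ∈ Preorder.frestrictLe (π := fun _ => Fin N) n ⁻¹'
        {Preorder.frestrictLe n y} ∧ x (n + 1) = y (n + 1)
      rw [← cyl_eq_preimage]
      simp only [cyl, Set.mem_ofPred_eq]
      constructor
      · exact fun h => ⟨fun k hk => h k (by omega), h _ le_rfl⟩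
      · rintro ⟨h, h'⟩ k hk
        rcases Nat.lt_or_ge n k with hk' | hk'
        · obtain rfl : k = n + 1 := by omega
          exact h'
        · exact h k hk'
    have h3 : D.kernel n (Preorder.frestrictLe (π := fun _ => Fin N) n y) {y (n + 1)} =
        ENNReal.ofReal (D.trans n (y n) (y (n + 1))) := letterMeasure_singleton _ _
    rw [h2, ← Measure.map_apply (by fun_prop)
      ((measurableSet_singleton _).prod (measurableSet_singleton _)), measure, ← h1,
      Measure.compProd_apply_prod (measurableSet_singleton _) (measurableSet_singleton _),
      lintegral_singleton, h3, Measure.map_apply (Preorder.measurable_frestrictLe n)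
      (measurableSet_singleton _), ← cyl_eq_preimage]
    change _ * D.measure _ = _
    rw [ih, ← ENNReal.ofReal_mul (D.trans_pos _ _ _).le, Finset.prod_range_succ]
    congr 1
    ring

lemma map_eq_of_cyl {μ ν : Measure (Words N)} {n : ℕ} (h : ∀ y, μ (cyl y n) = ν (cyl y n)) :
    μ.map (Preorder.frestrictLe (π := fun _ => Fin N) n) = ν.map (Preorder.frestrictLe n) := by
  refine Measure.ext_of_singleton fun a => ?_
  rw [Measure.map_apply (Preorder.measurable_frestrictLe n) (measurableSet_singleton _),
    Measure.map_apply (Preorder.measurable_frestrictLe n) (measurableSet_singleton _)]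
  let y : Words N := fun k => if hk : k ≤ n then a ⟨k, Finset.mem_Iic.2 hk⟩
    else a ⟨n, Finset.mem_Iic.2 le_rfl⟩
  have hy : Preorder.frestrictLe n y = a := by
    funext k
    have hk := Finset.mem_Iic.1 k.2
    simp [y, hk]
  rw [← hy, ← cyl_eq_preimage]
  exact h y

lemma cyl_eq_of_le {μ ν : Measure (Words N)} {m n : ℕ} (hmn : m ≤ n)
    (h : ∀ y, μ (cyl y n) = ν (cyl y n)) (y : Words N) : μ (cyl y m) = ν (cyl y m) := by
  have h1 := map_eq_of_cyl h
  have h2 : cyl y m = Preorder.frestrictLe (π := fun _ => Fin N) n ⁻¹'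
      {a | ∀ (k : ℕ) (hk : k ≤ m), a ⟨k, Finset.mem_Iic.2 (hk.trans hmn)⟩ = y k} := rfl
  rw [h2, ← Measure.map_apply (Preorder.measurable_frestrictLe n) (Set.toFinite _).measurableSet,
    ← Measure.map_apply (Preorder.measurable_frestrictLe n) (Set.toFinite _).measurableSet, h1]

/-- Finite measures on the space of words are determined by their values on cylinder sets. -/
lemma ext_of_cyl {μ ν : Measure (Words N)} [IsFiniteMeasure μ] [IsFiniteMeasure ν]
    (h : ∀ n y, μ (cyl y n) = ν (cyl y n)) : μ = ν := by
  have hμ : IsProjectiveLimit μ (fun I => ν.map I.restrict) := by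
    rw [isProjectiveLimit_nat_iff]
    · exact fun n => map_eq_of_cyl (h n)
    · intro I J hJI
      rw [Measure.map_map (Finset.measurable_restrict₂ _) (Finset.measurable_restrict _)]
      rfl
  exact hμ.unique fun I => rfl

/-- The Markov measure is quasi-stationary if
`∑ₙ |T⁽ⁿ⁾(xₙ,xₙ₊₁) / T⁽ⁿ⁺¹⁾(xₙ,xₙ₊₁) - 1| < ∞` for every infinite word `x₁x₂…`. -/
def IsQuasiStationary : Prop :=
  ∀ x : Words N, Summable fun n =>
    |D.trans n (x n) (x (n + 1)) / D.trans (n + 1) (x n) (x (n + 1)) - 1|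

/-- The ratios `T⁽ⁿ⁾(i,j) / T⁽ⁿ⁺¹⁾(i,j)`. -/
noncomputable def ratio (n : ℕ) (i j : Fin N) : ℝ := D.trans n i j / D.trans (n + 1) i j

/-- The infinite product `F(x₁x₂…) = ∏ₙ T⁽ⁿ⁾(xₙ,xₙ₊₁) / T⁽ⁿ⁺¹⁾(xₙ,xₙ₊₁)`. -/
noncomputable def F (x : Words N) : ℝ := ∏' n, D.ratio n (x n) (x (n + 1))

/-- The density `δ(j,x₁) λ(x₂) / (λ(x₁) T⁽¹⁾(x₁,x₂)) F(x₂x₃…)`. -/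
noncomputable def density (j : Fin N) (x : Words N) : ℝ :=
  if x 0 = j then
    D.init (x 1) / (D.init (x 0) * D.trans 0 (x 0) (x 1)) * D.F (shift x)
  else 0

/-- The function `f_j(x₁x₂…) = δ(j,x₁) √(λ(x₂) / (λ(x₁) T⁽¹⁾(x₁,x₂)) F(x₂x₃…))`. -/
noncomputable def weight (j : Fin N) (x : Words N) : ℝ := √(D.density j x)

lemma ratio_pos (n : ℕ) (i j : Fin N) : 0 < D.ratio n i j :=
  div_pos (D.trans_pos _ _ _) (D.trans_pos _ _ _)

variable {D}

lemma IsQuasiStationary.summable_entry (h : D.IsQuasiStationary) (i j : Fin N) :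
    Summable fun n => |D.ratio n i j - 1| := by
  have h1 := h fun n => if Even n then i else j
  have h2 := h fun n => if Even n then j else i
  refine Summable.of_nonneg_of_le (fun n => abs_nonneg _) (fun n => ?_) (h1.add h2)
  rcases Nat.even_or_odd n with hn | hn
  · have hn' : ¬ Even (n + 1) := by simpa [Nat.even_add_one] using hn
    simp [hn, hn', ratio]
  · have hn0 : ¬ Even n := by simpa using hn
    have hn' : Even (n + 1) := by simpa [Nat.even_add_one] using hn
    simp [hn0, hn', ratio]

lemma IsQuasiStationary.hasProd (h : D.IsQuasiStationary) (x : Words N) :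
    HasProd (fun n => D.ratio n (x n) (x (n + 1))) (D.F x) ∧ 0 < D.F x := by
  have h1 : Summable fun n => D.ratio n (x n) (x (n + 1)) - 1 := (h x).of_abs
  have h2 := Real.summable_log_one_add_of_summable h1
  simp only [add_sub_cancel] at h2
  have h3 := Real.hasProd_of_hasSum_log (fun n => D.ratio_pos n (x n) (x (n + 1))) h2.hasSum
  have h4 : D.F x = _ := h3.tprod_eq
  rw [h4]
  exact ⟨h3, Real.exp_pos _⟩

lemma IsQuasiStationary.F_pos (h : D.IsQuasiStationary) (x : Words N) : 0 < D.F x :=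
  (h.hasProd x).2

/-- The partial products of `F` converge pointwise. -/
lemma IsQuasiStationary.tendsto_prod (h : D.IsQuasiStationary) (x : Words N) :
    Tendsto (fun n => ∏ k ∈ Finset.range n, D.ratio k (x k) (x (k + 1))) atTop (𝓝 (D.F x)) :=
  (h.hasProd x).1.tendsto_prod_nat

/-- The partial products of `F` are uniformly bounded. -/
lemma IsQuasiStationary.exists_bound (h : D.IsQuasiStationary) :
    ∃ C : ℝ, ∀ (x : Words N) (n : ℕ), ∏ k ∈ Finset.range n, D.ratio k (x k) (x (k + 1)) ≤ C := by
  have hs : Summable fun n => ∑ i, ∑ j, |D.ratio n i j - 1| :=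
    summable_sum fun i _ => summable_sum fun j _ => h.summable_entry i j
  refine ⟨Real.exp (∑' n, ∑ i, ∑ j, |D.ratio n i j - 1|), fun x n => ?_⟩
  have h0 : ∀ m, 0 ≤ ∑ i, ∑ j, |D.ratio m i j - 1| := fun m =>
    Finset.sum_nonneg fun i _ => Finset.sum_nonneg fun j _ => abs_nonneg _
  calc ∏ k ∈ Finset.range n, D.ratio k (x k) (x (k + 1))
      ≤ ∏ k ∈ Finset.range n, Real.exp (∑ i, ∑ j, |D.ratio k i j - 1|) := by
        refine Finset.prod_le_prod (fun k _ => (D.ratio_pos _ _ _).le) fun k _ => ?_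
        have h1 : |D.ratio k (x k) (x (k + 1)) - 1| ≤ ∑ i, ∑ j, |D.ratio k i j - 1| :=
          (Finset.single_le_sum (f := fun j => |D.ratio k (x k) j - 1|)
            (fun j _ => abs_nonneg _) (Finset.mem_univ (x (k + 1)))).trans
          (Finset.single_le_sum (f := fun i => ∑ j, |D.ratio k i j - 1|)
            (fun i _ => Finset.sum_nonneg fun j _ => abs_nonneg _) (Finset.mem_univ (x k)))
        have h2 := le_abs_self (D.ratio k (x k) (x (k + 1)) - 1)
        have h3 := Real.add_one_le_exp (∑ i, ∑ j, |D.ratio k i j - 1|)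
        linarith
    _ = Real.exp (∑ k ∈ Finset.range n, ∑ i, ∑ j, |D.ratio k i j - 1|) :=
        (Real.exp_sum _ _).symm
    _ ≤ _ := Real.exp_le_exp.2 (hs.sum_le_tsum _ fun k _ => h0 k)

variable (D)

/-- The density `d(μ ∘ σ_j⁻¹)/dμ` on the σ-algebra generated by the first `n + 2` letters. -/
noncomputable def partialDensity (j : Fin N) (n : ℕ) (x : Words N) : ℝ :=
  if x 0 = j then
    D.init (x 1) / (D.init (x 0) * D.trans 0 (x 0) (x 1)) *
      ∏ k ∈ Finset.range n, D.ratio k (shift x k) (shift x (k + 1))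
  else 0

lemma measurable_of_letters {α : Type*} [MeasurableSpace α] (g : Fin N → Fin N → α) (k l : ℕ) :
    Measurable fun x : Words N => g (x k) (x l) :=
  (measurable_of_countable fun p : Fin N × Fin N => g p.1 p.2).comp
    (f := fun x : Words N => (x k, x l))
    ((measurable_pi_apply k).prodMk (measurable_pi_apply l))

lemma measurableSet_letter (j : Fin N) (k : ℕ) : MeasurableSet {x : Words N | x k = j} :=
  (measurable_pi_apply (X := fun _ : ℕ => Fin N) k) (measurableSet_singleton j)

lemma measurable_partialDensity (j : Fin N) (n : ℕ) : Measurable (D.partialDensity j n) := by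
  refine Measurable.ite (measurableSet_letter j 0) (Measurable.mul ?_ ?_) measurable_const
  · exact measurable_of_letters (fun a b => D.init b / (D.init a * D.trans 0 a b)) 0 1
  · refine Finset.measurable_prod _ fun k _ => ?_
    exact measurable_of_letters (D.ratio k) (k + 1) (k + 2)

lemma partialDensity_nonneg (j : Fin N) (n : ℕ) (x : Words N) : 0 ≤ D.partialDensity j n x := by
  unfold partialDensity
  split_ifs
  · exact mul_nonneg (div_nonneg (D.init_pos _).le
      (mul_nonneg (D.init_pos _).le (D.trans_pos _ _ _).le))
      (Finset.prod_nonneg fun k _ => (D.ratio_pos _ _ _).le)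
  · exact le_rfl

lemma partialDensity_mul (j : Fin N) (n : ℕ) (y : Words N) (hy : y 0 = j) :
    D.partialDensity j n y *
        (D.init (y 0) * ∏ k ∈ Finset.range (n + 1), D.trans k (y k) (y (k + 1))) =
      D.init (shift y 0) * ∏ k ∈ Finset.range n, D.trans k (shift y k) (shift y (k + 1)) := by
  have h1 : ∀ k, D.trans k (y (k + 1)) (y (k + 2)) =
      D.ratio k (y (k + 1)) (y (k + 2)) * D.trans (k + 1) (y (k + 1)) (y (k + 2)) := fun k =>
    (div_mul_cancel₀ _ (D.trans_pos _ _ _).ne').symm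
  have h2 := (D.init_pos (y 0)).ne'
  have h3 := (D.trans_pos 0 (y 0) (y 1)).ne'
  simp only [partialDensity, if_pos hy, shift, Finset.prod_range_succ']
  simp only [zero_add, add_assoc, Nat.reduceAdd]
  rw [Finset.prod_congr rfl fun k _ => h1 k, Finset.prod_mul_distrib]
  field_simp

lemma withDensity_partialDensity_cyl (j : Fin N) (n : ℕ) (y : Words N) :
    D.measure.withDensity (fun x => ENNReal.ofReal (D.partialDensity j n x)) (cyl y (n + 1)) =
      D.measure.map (branch j) (cyl y (n + 1)) := by
  have h1 : ∀ x ∈ cyl y (n + 1), D.partialDensity j n x = D.partialDensity j n y := by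
    intro x hx
    have hx' : ∀ k < n, shift x k = shift y k ∧ shift x (k + 1) = shift y (k + 1) := fun k hk =>
      ⟨hx (k + 1) (by omega), hx (k + 1 + 1) (by omega)⟩
    simp only [partialDensity, hx 0 (by omega), hx 1 (by omega)]
    rw [Finset.prod_congr rfl fun k hk => by
      rw [(hx' k (Finset.mem_range.1 hk)).1, (hx' k (Finset.mem_range.1 hk)).2]]
  rw [withDensity_apply _ (measurableSet_cyl _ _), Measure.map_apply (measurable_branch j)
    (measurableSet_cyl _ _), setLIntegral_congr_fun (g := fun _ => ENNReal.ofReal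
    (D.partialDensity j n y)) (measurableSet_cyl _ _) fun x hx => by simp only [h1 x hx],
    setLIntegral_const]
  by_cases hy : y 0 = j
  · have h2 : branch j ⁻¹' cyl y (n + 1) = cyl (shift y) n := by
      ext x
      constructor
      · intro h k hk
        exact h (k + 1) (by omega)
      · intro h k hk
        cases k with
        | zero => exact hy.symm
        | succ k => exact h k (by omega)
    rw [h2, measure_cyl, measure_cyl, ← D.partialDensity_mul j n y hy,
      ENNReal.ofReal_mul (D.partialDensity_nonneg _ _ _)]
  · have h2 : branch j ⁻¹' cyl y (n + 1) = ∅ := by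
      ext x
      simp only [Set.mem_preimage, Set.mem_empty_iff_false, iff_false]
      exact fun h => hy (h 0 (by omega)).symm
    rw [h2]
    simp [partialDensity, hy]

variable {D}

lemma IsQuasiStationary.tendsto_partialDensity (h : D.IsQuasiStationary) (j : Fin N)
    (x : Words N) : Tendsto (fun n => D.partialDensity j n x) atTop (𝓝 (D.density j x)) := by
  unfold partialDensity density
  split_ifs
  · exact (h.tendsto_prod (shift x)).const_mul _
  · exact tendsto_const_nhds

lemma IsQuasiStationary.measurable_density (h : D.IsQuasiStationary) (j : Fin N) :
    Measurable (D.density j) :=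
  measurable_of_tendsto_metrizable (fun n => D.measurable_partialDensity j n)
    (tendsto_pi_nhds.2 fun x => h.tendsto_partialDensity j x)

lemma IsQuasiStationary.measurable_weight (h : D.IsQuasiStationary) (j : Fin N) :
    Measurable (D.weight j) :=
  (h.measurable_density j).sqrt

lemma IsQuasiStationary.density_pos (h : D.IsQuasiStationary) {j : Fin N} {x : Words N}
    (hx : x 0 = j) : 0 < D.density j x := by
  rw [density, if_pos hx]
  exact mul_pos (div_pos (D.init_pos _) (mul_pos (D.init_pos _) (D.trans_pos _ _ _))) (h.F_pos _)

lemma density_of_ne {j : Fin N} {x : Words N} (hx : x 0 ≠ j) : D.density j x = 0 := if_neg hx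

lemma IsQuasiStationary.exists_partialDensity_le (h : D.IsQuasiStationary) (j : Fin N) :
    ∃ C : ℝ, ∀ n x, D.partialDensity j n x ≤ C := by
  obtain ⟨C, hC⟩ := h.exists_bound
  have hc : ∀ a b, 0 ≤ D.init b / (D.init a * D.trans 0 a b) := fun a b =>
    div_nonneg (D.init_pos _).le (mul_nonneg (D.init_pos _).le (D.trans_pos _ _ _).le)
  have hC0 : 0 ≤ C := by
    have h1 := hC (fun _ => j) 0
    simp only [Finset.range_zero, Finset.prod_empty] at h1
    linarith
  have h2 : ∀ a b, D.init b / (D.init a * D.trans 0 a b) ≤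
      ∑ a, ∑ b, D.init b / (D.init a * D.trans 0 a b) := fun a b =>
    (Finset.single_le_sum (f := fun b => D.init b / (D.init a * D.trans 0 a b))
      (fun b _ => hc a b) (Finset.mem_univ b)).trans
    (Finset.single_le_sum (f := fun a => ∑ b, D.init b / (D.init a * D.trans 0 a b))
      (fun a _ => Finset.sum_nonneg fun b _ => hc a b) (Finset.mem_univ a))
  have h3 : 0 ≤ ∑ a, ∑ b, D.init b / (D.init a * D.trans 0 a b) :=
    Finset.sum_nonneg fun a _ => Finset.sum_nonneg fun b _ => hc a b
  refine ⟨(∑ a, ∑ b, D.init b / (D.init a * D.trans 0 a b)) * C, fun n x => ?_⟩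
  unfold partialDensity
  split_ifs
  · exact mul_le_mul (h2 _ _) (hC _ _) (Finset.prod_nonneg fun k _ => (D.ratio_pos _ _ _).le) h3
  · exact mul_nonneg h3 hC0

/-- The function `D.density j` is the Radon–Nikodym derivative `d(μ ∘ σ_j⁻¹)/dμ`. -/
lemma IsQuasiStationary.map_branch (h : D.IsQuasiStationary) (j : Fin N) :
    D.measure.map (branch j) =
      D.measure.withDensity fun x => ENNReal.ofReal (D.density j x) := by
  obtain ⟨C, hC⟩ := h.exists_partialDensity_le j
  have hfin : IsFiniteMeasure (D.measure.withDensity fun x => ENNReal.ofReal (D.density j x)) := by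
    refine isFiniteMeasure_withDensity (ne_of_lt ?_)
    calc ∫⁻ x, ENNReal.ofReal (D.density j x) ∂D.measure
        ≤ ∫⁻ _, ENNReal.ofReal C ∂D.measure := lintegral_mono fun x => ENNReal.ofReal_le_ofReal
          (le_of_tendsto' (h.tendsto_partialDensity j x) fun n => hC n x)
      _ < ∞ := by simp
  have hfin' : IsFiniteMeasure (D.measure.map (branch j)) :=
    Measure.isFiniteMeasure_map _ _
  refine ext_of_cyl fun m y => ?_
  rw [withDensity_apply _ (measurableSet_cyl y m)]
  have h1 : Tendsto (fun n => ∫⁻ x in cyl y m, ENNReal.ofReal (D.partialDensity j n x) ∂D.measure)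
      atTop (𝓝 (∫⁻ x in cyl y m, ENNReal.ofReal (D.density j x) ∂D.measure)) := by
    refine tendsto_lintegral_of_dominated_convergence (fun _ => ENNReal.ofReal C)
      (fun n => (D.measurable_partialDensity j n).ennreal_ofReal)
      (fun n => ae_of_all _ fun x => ENNReal.ofReal_le_ofReal (hC n x))
      (by simp [ENNReal.mul_eq_top, measure_ne_top])
      (ae_of_all _ fun x => ENNReal.tendsto_ofReal (h.tendsto_partialDensity j x))
  refine tendsto_nhds_unique (tendsto_const_nhds.congr' ?_) h1
  filter_upwards [eventually_ge_atTop m] with n hn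
  rw [← withDensity_apply _ (measurableSet_cyl y m)]
  exact (cyl_eq_of_le (by omega : m ≤ n + 1) (D.withDensity_partialDensity_cyl j n) y).symm

lemma IsQuasiStationary.quasiMeasurePreserving_branch (h : D.IsQuasiStationary) (j : Fin N) :
    Measure.QuasiMeasurePreserving (branch j) D.measure D.measure :=
  ⟨measurable_branch j, by rw [h.map_branch j]; exact withDensity_absolutelyContinuous _ _⟩

lemma IsQuasiStationary.quasiMeasurePreserving_shift (h : D.IsQuasiStationary) :
    Measure.QuasiMeasurePreserving (shift : Words N → Words N) D.measure D.measure := by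
  refine ⟨measurable_shift, Measure.AbsolutelyContinuous.mk fun A hA hA0 => ?_⟩
  rw [Measure.map_apply measurable_shift hA]
  have h1 : ∀ j, D.measure (shift ⁻¹' A ∩ {x | x 0 = j}) = 0 := by
    intro j
    have h2 : D.measure.map (branch j) (shift ⁻¹' A) = 0 := by
      rw [Measure.map_apply (measurable_branch j) (measurable_shift hA)]
      exact hA0
    rw [h.map_branch j, withDensity_apply_eq_zero (h.measurable_density j).ennreal_ofReal] at h2
    refine measure_mono_null ?_ h2
    rintro x ⟨hx, hj⟩
    exact ⟨(ENNReal.ofReal_pos.2 (h.density_pos hj)).ne', hx⟩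
  refine measure_mono_null (t := ⋃ j, shift ⁻¹' A ∩ {x | x 0 = j}) (fun x hx => ?_)
    (measure_iUnion_null h1)
  exact Set.mem_iUnion.2 ⟨x 0, hx, rfl⟩

lemma IsQuasiStationary.aestronglyMeasurable_mul_comp_shift (h : D.IsQuasiStationary) (j : Fin N)
    {g : Words N → ℂ} (hg : AEStronglyMeasurable g D.measure) :
    AEStronglyMeasurable (fun x => (D.weight j x : ℂ) * g (shift x)) D.measure :=
  (Complex.measurable_ofReal.comp (h.measurable_weight j)).aestronglyMeasurable.mul
    (hg.comp_quasiMeasurePreserving h.quasiMeasurePreserving_shift)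

/-- The map `g ↦ f_j (g ∘ σ)` preserves the `L²` norm. -/
lemma IsQuasiStationary.eLpNorm_mul_comp_shift (h : D.IsQuasiStationary) (j : Fin N)
    {g : Words N → ℂ} (hg : AEStronglyMeasurable g D.measure) :
    eLpNorm (fun x => (D.weight j x : ℂ) * g (shift x)) 2 D.measure =
      eLpNorm g 2 D.measure := by
  have h1 : MeasurePreserving (shift : Words N → Words N) (D.measure.map (branch j))
      D.measure := by
    refine ⟨measurable_shift, ?_⟩
    rw [Measure.map_map measurable_shift (measurable_branch j)]
    exact Measure.map_id
  rw [← eLpNorm_comp_measurePreserving hg h1, h.map_branch j,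
    eLpNorm_eq_lintegral_rpow_enorm_toReal two_ne_zero ENNReal.ofNat_ne_top,
    eLpNorm_eq_lintegral_rpow_enorm_toReal two_ne_zero ENNReal.ofNat_ne_top,
    lintegral_withDensity_eq_lintegral_mul_non_measurable _
      (h.measurable_density j).ennreal_ofReal (ae_of_all _ fun x => ENNReal.ofReal_lt_top)]
  congr 1
  refine lintegral_congr fun x => ?_
  have h2 : 0 ≤ D.density j x := by
    by_cases hx : x 0 = j
    · exact (h.density_pos hx).le
    · exact (density_of_ne hx).ge
  have h3 : ‖(D.weight j x : ℂ)‖ₑ ^ (2 : ℝ) = ENNReal.ofReal (D.density j x) := by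
    rw [weight, ← ofReal_norm, Complex.norm_real, Real.norm_of_nonneg (Real.sqrt_nonneg _),
      ENNReal.ofReal_rpow_of_nonneg (Real.sqrt_nonneg _) (by norm_num)]
    congr 1
    rw [Real.rpow_two, Real.sq_sqrt h2]
  simp only [ENNReal.toReal_ofNat, enorm_mul, Pi.mul_apply, Function.comp_apply]
  rw [ENNReal.mul_rpow_of_nonneg _ _ (by norm_num), h3]

lemma IsQuasiStationary.memLp_mul_comp_shift (h : D.IsQuasiStationary) (j : Fin N)
    {g : Words N → ℂ} (hg : MemLp g 2 D.measure) :
    MemLp (fun x => (D.weight j x : ℂ) * g (shift x)) 2 D.measure :=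
  ⟨h.aestronglyMeasurable_mul_comp_shift j hg.1,
    by rw [h.eLpNorm_mul_comp_shift j hg.1]; exact hg.2⟩

/-- The isometry `S_j f = f_j (f ∘ σ)` of `L²(μ)`. -/
noncomputable def isometry (h : D.IsQuasiStationary) (j : Fin N) :
    Lp ℂ 2 D.measure →ₗᵢ[ℂ] Lp ℂ 2 D.measure where
  toFun f := (h.memLp_mul_comp_shift j (Lp.memLp f)).toLp
    (fun x => (D.weight j x : ℂ) * f (shift x))
  map_add' f g := by
    rw [← MemLp.toLp_add]
    refine MemLp.toLp_congr _ _ ?_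
    filter_upwards [h.quasiMeasurePreserving_shift.ae_eq_comp (Lp.coeFn_add f g)] with x hx
    simp only [Function.comp_apply, Pi.add_apply] at hx
    simp only [Pi.add_apply, hx, mul_add]
  map_smul' c f := by
    rw [RingHom.id_apply, ← MemLp.toLp_const_smul]
    refine MemLp.toLp_congr _ _ ?_
    filter_upwards [h.quasiMeasurePreserving_shift.ae_eq_comp (Lp.coeFn_smul c f)] with x hx
    simp only [Function.comp_apply, Pi.smul_apply, smul_eq_mul] at hx
    simp only [Pi.smul_apply, hx, smul_eq_mul]
    ring
  norm_map' f := by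
    change ‖(h.memLp_mul_comp_shift j (Lp.memLp f)).toLp
      (fun x => (D.weight j x : ℂ) * f (shift x))‖ = _
    rw [Lp.norm_toLp, h.eLpNorm_mul_comp_shift j (Lp.memLp f).1, Lp.norm_def]

lemma isometry_coeFn (h : D.IsQuasiStationary) (j : Fin N) (f : Lp ℂ 2 D.measure) :
    isometry h j f =ᵐ[D.measure] fun x => (D.weight j x : ℂ) * f (shift x) :=
  MemLp.coeFn_toLp (h.memLp_mul_comp_shift j (Lp.memLp f))

/-- The isometries have mutually orthogonal ranges. -/
lemma inner_isometry (h : D.IsQuasiStationary) {i j : Fin N} (hij : i ≠ j)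
    (f g : Lp ℂ 2 D.measure) : inner ℂ (isometry h i f) (isometry h j g) = 0 := by
  rw [L2.inner_def]
  refine integral_eq_zero_of_ae ?_
  filter_upwards [isometry_coeFn h i f, isometry_coeFn h j g] with x hi hj
  rw [hi, hj]
  by_cases hx : x 0 = i
  · have : D.weight j x = 0 := by
      rw [weight, density_of_ne fun h' => hij (hx.symm.trans h'), Real.sqrt_zero]
    simp [this]
  · have : D.weight i x = 0 := by rw [weight, density_of_ne hx, Real.sqrt_zero]
    simp [this]

/-- The range of `S_j` contains all functions that are supported on the words starting with
`j`. -/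
lemma exists_isometry_eq (h : D.IsQuasiStationary) (j : Fin N) (g : Lp ℂ 2 D.measure) :
    ∃ f : Lp ℂ 2 D.measure, isometry h j f =ᵐ[D.measure] {x : Words N | x 0 = j}.indicator g := by
  let u : Words N → ℂ := fun x => g (branch j x) / (D.weight j (branch j x) : ℂ)
  have hu : AEStronglyMeasurable u D.measure := by
    refine ((Lp.memLp g).1.comp_quasiMeasurePreserving
      (h.quasiMeasurePreserving_branch j)).mul ?_
    exact ((Complex.measurable_ofReal.comp
      ((h.measurable_weight j).comp (measurable_branch j))).inv).aestronglyMeasurable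
  have h1 : (fun x => (D.weight j x : ℂ) * u (shift x)) = {x : Words N | x 0 = j}.indicator g := by
    funext x
    by_cases hx : x 0 = j
    · have h2 : (D.weight j x : ℂ) ≠ 0 := by
        rw [Complex.ofReal_ne_zero]
        exact (Real.sqrt_pos.2 (h.density_pos hx)).ne'
      rw [Set.indicator_of_mem (show x ∈ {x : Words N | x 0 = j} from hx)]
      simp only [u, branch_shift hx]
      rw [mul_div_cancel₀ _ h2]
    · rw [Set.indicator_of_notMem (show x ∉ {x : Words N | x 0 = j} from hx), weight,
        density_of_ne hx]
      simp
  have hu2 : MemLp u 2 D.measure := by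
    refine ⟨hu, ?_⟩
    rw [← h.eLpNorm_mul_comp_shift j hu, h1]
    exact (eLpNorm_indicator_le _).trans_lt (Lp.memLp g).2
  refine ⟨hu2.toLp u, ?_⟩
  filter_upwards [isometry_coeFn h j (hu2.toLp u),
    h.quasiMeasurePreserving_shift.ae_eq_comp hu2.coeFn_toLp] with x hx hx'
  simp only [Function.comp_apply] at hx'
  rw [hx, hx']
  exact congrFun h1 x

/-- The representation of the Cuntz algebra on `L²(μ)` associated to a quasi-stationary Markov
measure `μ`, given by `S_j f = f_j (f ∘ σ)`. -/
noncomputable def cuntzRep (h : D.IsQuasiStationary) : CuntzRep N (Lp ℂ 2 D.measure) where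
  S j := (isometry h j).toContinuousLinearMap
  adjoint_comp i j := by
    split_ifs with hij
    · subst hij
      exact (ContinuousLinearMap.norm_map_iff_adjoint_comp_self _).1 (isometry h i).norm_map
    · ext1 f
      refine ext_inner_left ℂ fun g => ?_
      rw [ContinuousLinearMap.comp_apply, ContinuousLinearMap.adjoint_inner_right]
      simpa using inner_isometry h hij g f
  sum_comp_adjoint := by
    ext1 g
    choose f hf using fun j => exists_isometry_eq h j g
    have h1 : g = ∑ j, isometry h j (f j) := by
      refine Lp.ext ?_
      have h2 := Lp.coeFn_finsetSum (μ := D.measure) (p := 2) Finset.univ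
        fun j => isometry h j (f j)
      filter_upwards [h2, ae_all_iff.2 hf] with x hx hx'
      rw [hx, Finset.sum_apply, Finset.sum_congr rfl fun j _ => hx' j,
        Finset.sum_eq_single (x 0)]
      · exact (Set.indicator_of_mem (show x ∈ {y : Words N | y 0 = x 0} from rfl) _).symm
      · intro j _ hj
        exact Set.indicator_of_notMem (s := {y : Words N | y 0 = j})
          (fun hx0 : x 0 = j => hj hx0.symm) (g : Words N → ℂ)
      · simp
    have h3 : ∀ j, ContinuousLinearMap.adjoint (isometry h j).toContinuousLinearMap g = f j := by
      intro j
      refine ext_inner_left ℂ fun u => ?_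
      rw [ContinuousLinearMap.adjoint_inner_right, h1, inner_sum, Finset.sum_eq_single j]
      · exact (isometry h j).inner_map_map u (f j)
      · exact fun i _ hi => inner_isometry h hi.symm u (f i)
      · simp
    simp only [sum_apply, ContinuousLinearMap.comp_apply, h3]
    exact h1.symm

lemma cuntzRep_coeFn (h : D.IsQuasiStationary) (j : Fin N) (f : Lp ℂ 2 D.measure) :
    (cuntzRep h).S j f =ᵐ[D.measure] fun x => (D.weight j x : ℂ) * f (shift x) :=
  isometry_coeFn h j f

/-- The function
`Z_∞(x₁x₂…) = (λ'(x₁) / λ(x₁)) limsupₙ ∏_{k<n} T'⁽ᵏ⁾(xₖ,xₖ₊₁) / T⁽ᵏ⁾(xₖ,xₖ₊₁)`,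
with values in `[0, ∞]`. -/
noncomputable def limsupRatio (D D' : MarkovPair N) (x : Words N) : ℝ≥0∞ :=
  ENNReal.ofReal (D'.init (x 0) / D.init (x 0)) *
    limsup (fun n => ENNReal.ofReal (∏ k ∈ Finset.range n,
      D'.trans k (x k) (x (k + 1)) / D.trans k (x k) (x (k + 1)))) atTop

/-- The `n`-th term (counted from `n = 0`) of the series in the criterion:
`1 - ∑_j √(T'⁽ⁿ⁺¹⁾(xₙ₊₁, j)) √(T⁽ⁿ⁺¹⁾(xₙ₊₁, j))`. -/
noncomputable def hellingerTerm (D D' : MarkovPair N) (x : Words N) (n : ℕ) : ℝ :=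
  1 - ∑ j, √(D'.trans n (x n) j) * √(D.trans n (x n) j)

end MarkovPair

end CuntzMarkov

/-! ### Intertwiners of representations of the Cuntz algebra -/

namespace CuntzMarkov

namespace CuntzRep

variable {N : ℕ} {H K : Type*} [NormedAddCommGroup H] [InnerProductSpace ℂ H] [CompleteSpace H]
  [NormedAddCommGroup K] [InnerProductSpace ℂ K] [CompleteSpace K]

/-! Representations and measures. For `f` in `L²(μ)` the measure `|f|² μ` of the cylinder `i₁…iₙ` is
`‖S_{iₙ}* ⋯ S_{i₁}* f‖²`, so it depends only on how the representation acts on `f`. A unitary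
intertwiner, even one between subrepresentations, therefore satisfies `|f|² μ = |Uf|² μ'`
(`vectorMeasure_eq`). With `f = 1` an equivalence gives `μ ≪ μ'`. If `μ ⟂ μ'`, a measure absolutely
continuous with respect to both is zero, which forces disjointness. Conversely, let `p` be the
density of the absolutely continuous part of `μ` with respect to `μ'`. The operator `f ↦ f √p`
(`transfer`) is isometric on the complement of its kernel. It intertwines the representations,
because the image of `μ` under a branch has two Lebesgue decompositions, which must agree
(`density_mul_rnDeriv`). It is unitary for equivalent measures, and it vanishes for disjoint
representations, whence `p = 0`.

Measures and `Z_∞`. Let `Zₙ` be the ratio of the `μ'`-mass to the `μ`-mass of the cylinder of `x` up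
to index `n`. The variables `1 / (1 + Zₙ)` are the conditional expectations of `dμ/d(μ + μ')`, so
Lévy's upward theorem makes them converge to it. Hence `Z_∞ = ∞` exactly where `dμ/d(μ + μ') = 0`,
and `Z_∞ = 0` exactly where `dμ'/d(μ + μ') = 0`, almost everywhere
(`limsupRatio_eq_top_iff_and_eq_zero_iff`).

`Z_∞` and the series: a conditional form of Kakutani's argument. Under `μ'` the factors `√(T/T')`
have conditional mean square 1, and their conditional means are the affinities `∑ √T' √T`. If the
series diverges, the product of affinities tends to 0. The product of the factors divided by their
affinities has mean 1, so its liminf is finite almost everywhere by Fatou, and this excludes bounded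
`Zₙ`. If the series converges, a second moment bound for a suitably stopped product shows that `Zₙ`
can rarely grow fourfold once the tail is small. Thus the series converges exactly where `Z_∞ < ∞`,
up to a `μ'`-null set (`ae_summable_iff_lt_top`). -/

lemma sum_S_adjoint (π : CuntzRep N H) (x : H) :
    ∑ i, π.S i (ContinuousLinearMap.adjoint (π.S i) x) = x := by
  simpa using DFunLike.congr_fun π.sum_comp_adjoint x

lemma adjoint_S (π : CuntzRep N H) (i j : Fin N) (x : H) :
    ContinuousLinearMap.adjoint (π.S i) (π.S j x) = if i = j then x else 0 := by
  have h := DFunLike.congr_fun (π.adjoint_comp i j) x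
  rw [ContinuousLinearMap.comp_apply] at h
  rw [h]
  split_ifs <;> simp

lemma adjoint_sum_S (π : CuntzRep N H) (j : Fin N) (x : Fin N → H) :
    ContinuousLinearMap.adjoint (π.S j) (∑ i, π.S i (x i)) = x j := by
  simp [map_sum, adjoint_S]

/-- An intertwiner of the isometries also intertwines their adjoints. -/
lemma intertwines_adjoint (π : CuntzRep N H) (ρ : CuntzRep N K) (V : H →ₗ[ℂ] K)
    (hV : ∀ i x, V (π.S i x) = ρ.S i (V x)) (i : Fin N) (x : H) :
    V (ContinuousLinearMap.adjoint (π.S i) x) = ContinuousLinearMap.adjoint (ρ.S i) (V x) := by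
  -- Applying `V` to `x = ∑ S_i S_i* x` expands `V x` along the ranges of the `ρ.S i`; the adjoint
  -- reads off the `i`-th coefficient.
  conv_rhs => rw [← π.sum_S_adjoint x, map_sum]
  simp only [hV]
  rw [adjoint_sum_S]

/-- An intertwiner that is isometric on the orthogonal complement of its kernel maps that
complement onto an equivalent subrepresentation. -/
lemma Disjoint.eq_zero_of_intertwines {π : CuntzRep N H} {ρ : CuntzRep N K} (hd : π.Disjoint ρ)
    (V : H →ₗ[ℂ] K) (hV : ∀ i x, V (π.S i x) = ρ.S i (V x))
    (hk : IsClosed (LinearMap.ker V : Set H))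
    (hiso : ∀ x ∈ (LinearMap.ker V)ᗮ, ‖V x‖ = ‖x‖) (x : H) : V x = 0 := by
  set M : Submodule ℂ H := (LinearMap.ker V)ᗮ with hM
  have hV' := intertwines_adjoint π ρ V hV
  -- The kernel is invariant under all `S i` and their adjoints, so its orthogonal complement is
  -- too.
  have hMred : π.IsReducing M := by
    refine ⟨Submodule.isClosed_orthogonal _, fun i x hx => ⟨?_, ?_⟩⟩
    · rw [hM, Submodule.mem_orthogonal] at hx ⊢
      intro u hu
      rw [← ContinuousLinearMap.adjoint_inner_left]
      refine hx _ ?_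
      rw [LinearMap.mem_ker, hV', LinearMap.mem_ker.1 hu, map_zero]
    · rw [hM, Submodule.mem_orthogonal] at hx ⊢
      intro u hu
      rw [ContinuousLinearMap.adjoint_inner_right]
      refine hx _ ?_
      rw [LinearMap.mem_ker, hV, LinearMap.mem_ker.1 hu, map_zero]
  let W : M →ₗᵢ[ℂ] K := ⟨V.domRestrict M, fun x => hiso x x.2⟩
  have hWa : ∀ x : M, W x = V x := fun _ => rfl
  have hcomp : CompleteSpace M := (Submodule.isClosed_orthogonal _).completeSpace_coe
  have hLred : ρ.IsReducing (LinearMap.range W.toLinearMap) := by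
    refine ⟨?_, ?_⟩
    · exact W.isometry.isClosedEmbedding.isClosed_range
    · rintro i _ ⟨y, rfl⟩
      exact ⟨⟨⟨_, (hMred.2 i y y.2).1⟩, hV i y⟩, ⟨⟨_, (hMred.2 i y y.2).2⟩, hV' i y⟩⟩
  have hbot : M = ⊥ := by
    refine hd M _ hMred hLred W.equivRange fun i x y hxy => ?_
    change V y = ρ.S i (V x)
    rw [hxy, hV]
  have : CompleteSpace (LinearMap.ker V) := hk.completeSpace_coe
  have htop : LinearMap.ker V = ⊤ := (Submodule.orthogonal_eq_bot_iff).1 hbot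
  exact LinearMap.mem_ker.1 (htop ▸ Submodule.mem_top)

end CuntzRep

/-! ### The measure of a vector as an invariant of the representation -/

namespace MarkovPair

variable {N : ℕ} {D D' : MarkovPair N}

/-- The measure `|f|² μ`. -/
noncomputable def vectorMeasure (D : MarkovPair N) (f : Lp ℂ 2 D.measure) : Measure (Words N) :=
  D.measure.withDensity fun x => ‖f x‖ₑ ^ 2

lemma lintegral_sq_eq {Ω : Type*} [MeasurableSpace Ω] {μ : Measure Ω} (f : Lp ℂ 2 μ) :
    ∫⁻ x, ‖f x‖ₑ ^ 2 ∂μ = ‖f‖ₑ ^ 2 := by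
  have h1 := eLpNorm_eq_lintegral_rpow_enorm_toReal (μ := μ) (f := f) two_ne_zero
    ENNReal.ofNat_ne_top
  have h2 : ‖f‖ₑ = eLpNorm f 2 μ := Lp.enorm_def f
  rw [h2, h1, ← ENNReal.rpow_natCast, ← ENNReal.rpow_mul]
  simp

lemma vectorMeasure_univ (f : Lp ℂ 2 D.measure) : D.vectorMeasure f Set.univ = ‖f‖ₑ ^ 2 := by
  rw [vectorMeasure, withDensity_apply _ MeasurableSet.univ, Measure.restrict_univ,
    lintegral_sq_eq]

instance (f : Lp ℂ 2 D.measure) : IsFiniteMeasure (D.vectorMeasure f) :=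
  ⟨by rw [vectorMeasure_univ]; exact ENNReal.pow_lt_top enorm_lt_top⟩

lemma vectorMeasure_absolutelyContinuous (f : Lp ℂ 2 D.measure) :
    D.vectorMeasure f ≪ D.measure := withDensity_absolutelyContinuous _ _

lemma IsQuasiStationary.density_nonneg (h : D.IsQuasiStationary) (j : Fin N) (x : Words N) :
    0 ≤ D.density j x := by
  by_cases hx : x 0 = j
  · exact (h.density_pos hx).le
  · exact (density_of_ne hx).ge

lemma IsQuasiStationary.enorm_weight_sq (h : D.IsQuasiStationary) (j : Fin N) (x : Words N) :
    ‖(D.weight j x : ℂ)‖ₑ ^ 2 = ENNReal.ofReal (D.density j x) := by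
  rw [weight, ← ofReal_norm, Complex.norm_real, Real.norm_of_nonneg (Real.sqrt_nonneg _),
    ← ENNReal.ofReal_pow (Real.sqrt_nonneg _), Real.sq_sqrt (h.density_nonneg j x)]

/-- In `f = ∑ S_j S_j* f` only the term with `j = x 0` survives at `x`, because the other weights
vanish there. -/
lemma eq_weight_mul (h : D.IsQuasiStationary) (f : Lp ℂ 2 D.measure) :
    ∀ᵐ x ∂D.measure, f x = D.weight (x 0) x *
      (ContinuousLinearMap.adjoint ((cuntzRep h).S (x 0)) f : Lp ℂ 2 D.measure) (shift x) := by
  have h1 := Lp.coeFn_finsetSum (μ := D.measure) (p := 2) Finset.univ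
    fun j => (cuntzRep h).S j (ContinuousLinearMap.adjoint ((cuntzRep h).S j) f)
  rw [CuntzRep.sum_S_adjoint] at h1
  filter_upwards [h1, ae_all_iff.2 fun j => cuntzRep_coeFn h j
    (ContinuousLinearMap.adjoint ((cuntzRep h).S j) f)] with x hx hx'
  rw [hx, Finset.sum_apply, Finset.sum_congr rfl fun j _ => hx' j, Finset.sum_eq_single (x 0)]
  · intro j _ hj
    rw [weight, density_of_ne hj.symm]
    simp
  · simp

/-- The recursion `(|f|² μ)(j A) = (|S_j* f|² μ)(A)`. -/
lemma vectorMeasure_apply (h : D.IsQuasiStationary) (f : Lp ℂ 2 D.measure) {j : Fin N}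
    {A : Set (Words N)} (hA : MeasurableSet A) (hj : ∀ x ∈ A, x 0 = j) :
    D.vectorMeasure f A = D.vectorMeasure (ContinuousLinearMap.adjoint ((cuntzRep h).S j) f)
      (branch j ⁻¹' A) := by
  set g : Lp ℂ 2 D.measure := ContinuousLinearMap.adjoint ((cuntzRep h).S j) f with hg
  have hgm : Measurable fun x => ‖g (shift x)‖ₑ ^ 2 :=
    ((Lp.stronglyMeasurable g).measurable.comp measurable_shift).enorm.pow_const 2
  rw [vectorMeasure, vectorMeasure, withDensity_apply _ hA,
    withDensity_apply _ (measurable_branch j hA)]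
  calc ∫⁻ x in A, ‖f x‖ₑ ^ 2 ∂D.measure
      = ∫⁻ x in A, ENNReal.ofReal (D.density j x) * ‖g (shift x)‖ₑ ^ 2 ∂D.measure := by
        refine setLIntegral_congr_fun_ae hA ?_
        filter_upwards [eq_weight_mul h f] with x hx hxA
        rw [hx, hj x hxA, enorm_mul, mul_pow, h.enorm_weight_sq]
    _ = ∫⁻ x in A, ‖g (shift x)‖ₑ ^ 2 ∂(D.measure.map (branch j)) := by
        rw [h.map_branch j, setLIntegral_withDensity_eq_setLIntegral_mul _
          (h.measurable_density j).ennreal_ofReal hgm hA]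
        rfl
    _ = ∫⁻ x in branch j ⁻¹' A, ‖g x‖ₑ ^ 2 ∂D.measure := by
        rw [setLIntegral_map hA hgm (measurable_branch j)]
        rfl

lemma branch_preimage_cyl_succ (y : Words N) (n : ℕ) :
    branch (y 0) ⁻¹' cyl y (n + 1) = cyl (shift y) n := by
  ext x
  constructor
  · exact fun h k hk => h (k + 1) (by omega)
  · intro h k hk
    cases k with
    | zero => rfl
    | succ k => exact h k (by omega)

lemma branch_preimage_cyl_zero (y : Words N) : branch (y 0) ⁻¹' cyl y 0 = Set.univ := by
  ext x
  simp [cyl]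

/-- Vectors that are related by a relation that is isometric and compatible with the adjoints of
the isometries have the same vector measure. -/
lemma vectorMeasure_eq (h : D.IsQuasiStationary) (h' : D'.IsQuasiStationary)
    (R : Lp ℂ 2 D.measure → Lp ℂ 2 D'.measure → Prop) (hn : ∀ f g, R f g → ‖f‖ₑ = ‖g‖ₑ)
    (hR : ∀ f g, R f g → ∀ i, R (ContinuousLinearMap.adjoint ((cuntzRep h).S i) f)
      (ContinuousLinearMap.adjoint ((cuntzRep h').S i) g))
    {f : Lp ℂ 2 D.measure} {g : Lp ℂ 2 D'.measure} (hfg : R f g) :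
    D.vectorMeasure f = D'.vectorMeasure g := by
  refine ext_of_cyl fun n => ?_
  -- Each step strips one letter and replaces the vectors by their images under an adjoint, so the
  -- pair has to vary. The relation `R`, rather than a map, also covers unitaries defined only on a
  -- subspace.
  induction n generalizing f g with
  | zero =>
    intro y
    have hy : ∀ x ∈ cyl y 0, x 0 = y 0 := fun x hx => hx 0 le_rfl
    rw [vectorMeasure_apply h f (measurableSet_cyl y 0) hy,
      vectorMeasure_apply h' g (measurableSet_cyl y 0) hy, branch_preimage_cyl_zero,
      vectorMeasure_univ, vectorMeasure_univ, hn _ _ (hR _ _ hfg _)]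
  | succ n ih =>
    intro y
    have hy : ∀ x ∈ cyl y (n + 1), x 0 = y 0 := fun x hx => hx 0 (Nat.zero_le _)
    rw [vectorMeasure_apply h f (measurableSet_cyl y _) hy,
      vectorMeasure_apply h' g (measurableSet_cyl y _) hy, branch_preimage_cyl_succ]
    exact ih (hR _ _ hfg _) _

/-- The constant function 1 has vector measure `μ`; its image under the unitary has the same vector
measure, which is given by a density with respect to `μ'`. -/
lemma absolutelyContinuous_of_equivalent (h : D.IsQuasiStationary) (h' : D'.IsQuasiStationary)
    (he : (cuntzRep h).Equivalent (cuntzRep h')) : D.measure ≪ D'.measure := by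
  obtain ⟨U, hU⟩ := he
  have h1 : MemLp (fun _ : Words N => (1 : ℂ)) 2 D.measure := memLp_const 1
  have h2 := vectorMeasure_eq h h' (fun f g => U f = g) (fun f g hfg => by
    rw [← hfg, ← ofReal_norm, ← ofReal_norm, U.norm_map]) (fun f g hfg i => by
    rw [← hfg]
    exact CuntzRep.intertwines_adjoint _ _ U.toLinearEquiv.toLinearMap hU i f)
    (f := h1.toLp _) rfl
  have h3 : D.vectorMeasure (h1.toLp _) = D.measure := by
    conv_rhs => rw [← withDensity_one (μ := D.measure)]
    refine withDensity_congr_ae ?_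
    filter_upwards [h1.coeFn_toLp] with x hx
    rw [hx, enorm_one, one_pow, Pi.one_apply]
  rw [← h3, h2]
  exact vectorMeasure_absolutelyContinuous _

lemma _root_.CuntzMarkov.CuntzRep.Equivalent.symm {H K : Type*} [NormedAddCommGroup H]
    [InnerProductSpace ℂ H] [CompleteSpace H] [NormedAddCommGroup K] [InnerProductSpace ℂ K]
    [CompleteSpace K] {π : CuntzRep N H} {ρ : CuntzRep N K} (he : π.Equivalent ρ) :
    ρ.Equivalent π := by
  obtain ⟨U, hU⟩ := he
  refine ⟨U.symm, fun i x => ?_⟩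
  rw [LinearIsometryEquiv.symm_apply_eq, hU, U.apply_symm_apply]

/-- A vector `x` of a common subrepresentation satisfies `|x|² μ = |Ux|² μ'`. This measure is
absolutely continuous with respect to both `μ` and `μ'`, hence singular to itself, hence zero. -/
lemma disjoint_of_mutuallySingular (h : D.IsQuasiStationary) (h' : D'.IsQuasiStationary)
    (hs : D.measure ⟂ₘ D'.measure) : (cuntzRep h).Disjoint (cuntzRep h') := by
  intro M L hM hL U hU
  rw [Submodule.eq_bot_iff]
  intro x hx
  have h1 := vectorMeasure_eq h h' (fun f g => ∃ y : M, (y : Lp ℂ 2 D.measure) = f ∧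
      (U y : Lp ℂ 2 D'.measure) = g) (by
    rintro _ _ ⟨y, rfl, rfl⟩
    have h2 : ‖(U y : Lp ℂ 2 D'.measure)‖ = ‖(y : Lp ℂ 2 D.measure)‖ := U.norm_map y
    rw [← ofReal_norm, ← ofReal_norm, h2]) (by
    rintro _ _ ⟨y, rfl, rfl⟩ i
    refine ⟨⟨_, (hM.2 i y y.2).2⟩, rfl, ?_⟩
    -- `U` is only known to commute with the `S j`; expanding `y` inside `M` transfers this to the
    -- adjoints.
    have h3 : y = ∑ j, (⟨_, (hM.2 j _ (hM.2 j y y.2).2).1⟩ : M) := by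
      apply Subtype.ext
      rw [AddSubmonoidClass.coe_finsetSum]
      exact (CuntzRep.sum_S_adjoint _ _).symm
    conv_rhs => rw [h3]
    rw [map_sum, AddSubmonoidClass.coe_finsetSum, Finset.sum_congr rfl fun j _ =>
      hU j ⟨_, (hM.2 j y y.2).2⟩ ⟨_, (hM.2 j _ (hM.2 j y y.2).2).1⟩ rfl,
      CuntzRep.adjoint_sum_S]) ⟨⟨x, hx⟩, rfl, rfl⟩
  have h4 : D.vectorMeasure x ⟂ₘ D.vectorMeasure x := by
    refine (hs.mono_ac (vectorMeasure_absolutelyContinuous x) ?_)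
    rw [h1]
    exact vectorMeasure_absolutelyContinuous _
  rw [Measure.MutuallySingular.self_iff] at h4
  have h5 := vectorMeasure_univ x
  rw [h4] at h5
  simpa using h5.symm

end MarkovPair
end CuntzMarkov

/-! ### The operator `f ↦ f √(dμ/dν)` for measures without absolute continuity -/

namespace CuntzMarkov
namespace MarkovPair

variable {N : ℕ} {D D' : MarkovPair N}

/-- The square root of the density of the absolutely continuous part of `μ` with respect to
`ν`. -/
noncomputable def sqrtDeriv {Ω : Type*} [MeasurableSpace Ω] (μ ν : Measure Ω) (x : Ω) : ℝ :=
  √(μ.rnDeriv ν x).toReal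

section

variable {Ω : Type*} [MeasurableSpace Ω] (μ ν : Measure Ω)

lemma measurable_sqrtDeriv : Measurable (sqrtDeriv μ ν) :=
  (Measure.measurable_rnDeriv μ ν).ennreal_toReal.sqrt

lemma enorm_sqrtDeriv_sq [IsFiniteMeasure μ] :
    ∀ᵐ x ∂ν, ‖(sqrtDeriv μ ν x : ℂ)‖ₑ ^ 2 = μ.rnDeriv ν x := by
  filter_upwards [Measure.rnDeriv_lt_top μ ν] with x hx
  rw [sqrtDeriv, ← ofReal_norm, Complex.norm_real, Real.norm_of_nonneg (Real.sqrt_nonneg _),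
    ← ENNReal.ofReal_pow (Real.sqrt_nonneg _), Real.sq_sqrt ENNReal.toReal_nonneg,
    ENNReal.ofReal_toReal hx.ne]

/-- A `μ`-null set may have positive `ν`-measure, but the absolutely continuous part of `μ` does not
charge it, so the factor `√(dμ/dν)` vanishes there `ν`-almost everywhere. This makes `transfer` well
defined on classes. -/
lemma sqrtDeriv_mul_congr {f g : Ω → ℂ} (hfg : f =ᵐ[μ] g) :
    (fun x => (sqrtDeriv μ ν x : ℂ) * f x) =ᵐ[ν] fun x => (sqrtDeriv μ ν x : ℂ) * g x := by
  have h1 : ∀ᵐ x ∂(ν.withDensity (μ.rnDeriv ν)), f x = g x :=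
    (Measure.absolutelyContinuous_of_le (Measure.withDensity_rnDeriv_le μ ν)).ae_le hfg
  rw [ae_withDensity_iff (Measure.measurable_rnDeriv μ ν)] at h1
  filter_upwards [h1] with x hx
  by_cases h0 : μ.rnDeriv ν x = 0
  · simp [sqrtDeriv, h0]
  · rw [hx h0]

lemma memLp_two_iff_lintegral {f : Ω → ℂ} (hf : AEStronglyMeasurable f μ) :
    MemLp f 2 μ ↔ ∫⁻ x, ‖f x‖ₑ ^ 2 ∂μ < ∞ := by
  have h1 := eLpNorm_lt_top_iff_lintegral_rpow_enorm_lt_top (μ := μ) (f := f) two_ne_zero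
    ENNReal.ofNat_ne_top
  simp only [ENNReal.toReal_ofNat, ENNReal.rpow_two] at h1
  exact ⟨fun h => h1.1 h.2, fun h => ⟨hf, h1.2 h⟩⟩

variable [IsFiniteMeasure μ]

lemma lintegral_sqrtDeriv_mul {f : Ω → ℂ} (hf : Measurable f) :
    ∫⁻ x, ‖(sqrtDeriv μ ν x : ℂ) * f x‖ₑ ^ 2 ∂ν =
      ∫⁻ x, ‖f x‖ₑ ^ 2 ∂(ν.withDensity (μ.rnDeriv ν)) := by
  rw [lintegral_withDensity_eq_lintegral_mul _ (Measure.measurable_rnDeriv μ ν)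
    (hf.enorm.pow_const 2)]
  refine lintegral_congr_ae ?_
  filter_upwards [enorm_sqrtDeriv_sq μ ν] with x hx
  rw [enorm_mul, mul_pow, hx, Pi.mul_apply]

lemma memLp_sqrtDeriv_mul (f : Lp ℂ 2 μ) :
    MemLp (fun x => (sqrtDeriv μ ν x : ℂ) * f x) 2 ν := by
  have hf := (Lp.stronglyMeasurable f).measurable
  rw [memLp_two_iff_lintegral, lintegral_sqrtDeriv_mul μ ν hf]
  · refine (lintegral_mono' (Measure.withDensity_rnDeriv_le μ ν) le_rfl).trans_lt ?_
    rw [lintegral_sq_eq]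
    exact ENNReal.pow_lt_top enorm_lt_top
  · exact ((Complex.measurable_ofReal.comp (measurable_sqrtDeriv μ ν)).mul hf).aestronglyMeasurable

/-- The operator `f ↦ f √(dμ/dν)` from `L²(μ)` to `L²(ν)`. -/
noncomputable def transfer : Lp ℂ 2 μ →ₗ[ℂ] Lp ℂ 2 ν where
  toFun f := (memLp_sqrtDeriv_mul μ ν f).toLp _
  map_add' f g := by
    rw [← MemLp.toLp_add]
    refine MemLp.toLp_congr _ _ ?_
    filter_upwards [sqrtDeriv_mul_congr μ ν (Lp.coeFn_add f g)] with x hx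
    simp only [hx, Pi.add_apply, mul_add]
  map_smul' c f := by
    rw [RingHom.id_apply, ← MemLp.toLp_const_smul]
    refine MemLp.toLp_congr _ _ ?_
    filter_upwards [sqrtDeriv_mul_congr μ ν (Lp.coeFn_smul c f)] with x hx
    simp only [hx, Pi.smul_apply, smul_eq_mul]
    ring

lemma transfer_coeFn (f : Lp ℂ 2 μ) :
    transfer μ ν f =ᵐ[ν] fun x => (sqrtDeriv μ ν x : ℂ) * f x :=
  MemLp.coeFn_toLp (memLp_sqrtDeriv_mul μ ν f)

lemma enorm_transfer_sq (f : Lp ℂ 2 μ) : ‖transfer μ ν f‖ₑ ^ 2 =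
    ∫⁻ x, ‖f x‖ₑ ^ 2 ∂(ν.withDensity (μ.rnDeriv ν)) := by
  rw [← lintegral_sqrtDeriv_mul μ ν (Lp.stronglyMeasurable f).measurable, ← lintegral_sq_eq]
  refine lintegral_congr_ae ?_
  filter_upwards [transfer_coeFn μ ν f] with x hx
  rw [hx]

variable {μ ν} in
lemma enorm_eq_of_sq {a b : ℝ≥0∞} (h : a ^ 2 = b ^ 2) : a = b :=
  (ENNReal.pow_right_strictMono two_ne_zero).injective h

lemma norm_transfer_le (f : Lp ℂ 2 μ) : ‖transfer μ ν f‖ ≤ ‖f‖ := by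
  have h1 : ‖transfer μ ν f‖ₑ ^ 2 ≤ ‖f‖ₑ ^ 2 := by
    rw [enorm_transfer_sq, ← lintegral_sq_eq]
    exact lintegral_mono' (Measure.withDensity_rnDeriv_le μ ν) le_rfl
  have h2 := (ENNReal.pow_right_strictMono two_ne_zero).le_iff_le.1 h1
  rwa [← ofReal_norm, ← ofReal_norm, ENNReal.ofReal_le_ofReal_iff (norm_nonneg _)] at h2

lemma isClosed_ker_transfer : IsClosed (LinearMap.ker (transfer μ ν) : Set (Lp ℂ 2 μ)) :=
  ((transfer μ ν).mkContinuous 1 fun f => by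
    simpa using norm_transfer_le μ ν f).isClosed_ker

variable [IsFiniteMeasure ν]

/-- The transfer operator is isometric on the orthogonal complement of its kernel. -/
lemma norm_transfer_of_mem_orthogonal (f : Lp ℂ 2 μ)
    (hf : f ∈ (LinearMap.ker (transfer μ ν))ᗮ) : ‖transfer μ ν f‖ = ‖f‖ := by
  obtain ⟨S, hS, hS1, hS2⟩ := Measure.mutuallySingular_singularPart μ ν
  -- `S` is null for the singular part, its complement is null for `ν`
  have hind : MemLp (Sᶜ.indicator f) 2 μ := (Lp.memLp f).indicator hS.compl
  -- The set `Sᶜ` is `ν`-null, so functions living on it are sent to zero.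
  have hker : hind.toLp _ ∈ LinearMap.ker (transfer μ ν) := by
    rw [LinearMap.mem_ker]
    refine Lp.ext ?_
    have h3 : ∀ᵐ x ∂ν, x ∈ S := by
      rw [ae_iff]
      exact hS2
    filter_upwards [transfer_coeFn μ ν (hind.toLp _), sqrtDeriv_mul_congr μ ν hind.coeFn_toLp, h3,
      Lp.coeFn_zero ℂ 2 ν] with x hx hx' hxS h0
    rw [hx, hx', h0, Set.indicator_of_notMem (s := Sᶜ) (fun h => h hxS)]
    simp
  have h1 := (Submodule.mem_orthogonal _ _).1 hf _ hker
  -- The inner products of `1_{Sᶜ} f` with itself and with `f` coincide, and the latter is zero;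
  -- hence `f` vanishes on `Sᶜ`.
  have h2 : inner ℂ (hind.toLp _) (hind.toLp _) = (0 : ℂ) := by
    rw [← h1, L2.inner_def, L2.inner_def]
    refine integral_congr_ae ?_
    filter_upwards [hind.coeFn_toLp] with x hx
    rw [hx]
    by_cases hxS : x ∈ Sᶜ
    · rw [Set.indicator_of_mem hxS]
    · rw [Set.indicator_of_notMem hxS]
      simp
  have h3 : ∀ᵐ x ∂μ, x ∈ Sᶜ → f x = 0 := by
    rw [inner_self_eq_zero] at h2
    have h4 := hind.coeFn_toLp
    rw [h2] at h4
    filter_upwards [h4, Lp.coeFn_zero ℂ 2 μ] with x hx h0 hxS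
    rw [h0, Set.indicator_of_mem hxS] at hx
    exact hx.symm
  have h4 : ‖transfer μ ν f‖ₑ ^ 2 = ‖f‖ₑ ^ 2 := by
    rw [enorm_transfer_sq, ← lintegral_sq_eq]
    -- `Sᶜ` carries the singular part, the only part of the norm that the operator loses.
    have h5 : ∫⁻ x, ‖f x‖ₑ ^ 2 ∂(μ.singularPart ν) = 0 := by
      rw [lintegral_eq_zero_iff ((Lp.stronglyMeasurable f).measurable.enorm.pow_const 2)]
      have h6 : ∀ᵐ x ∂(μ.singularPart ν), x ∈ Sᶜ := by
        rw [ae_iff]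
        simpa using hS1
      filter_upwards [h6, (Measure.absolutelyContinuous_of_le
        (Measure.singularPart_le μ ν)).ae_le h3] with x hx hx'
      simp [hx' hx]
    have h6 : ∫⁻ x, ‖f x‖ₑ ^ 2 ∂μ = ∫⁻ x, ‖f x‖ₑ ^ 2 ∂(μ.singularPart ν) +
        ∫⁻ x, ‖f x‖ₑ ^ 2 ∂(ν.withDensity (μ.rnDeriv ν)) := by
      rw [← lintegral_add_measure, ← Measure.haveLebesgueDecomposition_add μ ν]
    rw [h6, h5, zero_add]
  have h5 := enorm_eq_of_sq h4
  rw [← ofReal_norm, ← ofReal_norm] at h5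
  rwa [ENNReal.ofReal_eq_ofReal_iff (norm_nonneg _) (norm_nonneg _)] at h5

end

/-! ### The transfer operator between two Markov measures -/

instance (D D' : MarkovPair N) : D.measure.HaveLebesgueDecomposition D'.measure :=
  Measure.haveLebesgueDecomposition_of_sigmaFinite _ _

/-- The cocycle identity for the density of the absolutely continuous part. -/
lemma density_mul_rnDeriv (h : D.IsQuasiStationary) (h' : D'.IsQuasiStationary) (j : Fin N) :
    ∀ᵐ x ∂D'.measure, ENNReal.ofReal (D.density j x) * D.measure.rnDeriv D'.measure x =
      ENNReal.ofReal (D'.density j x) * D.measure.rnDeriv D'.measure (shift x) := by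
  set μ := D.measure with hμ
  set ν := D'.measure with hν
  have hdec : μ.HaveLebesgueDecomposition ν := inferInstanceAs
    (D.measure.HaveLebesgueDecomposition D'.measure)
  set p := μ.rnDeriv ν with hp
  have hpm : Measurable p := Measure.measurable_rnDeriv μ ν
  have hd := (h.measurable_density j).ennreal_ofReal
  have hd' := (h'.measurable_density j).ennreal_ofReal
  -- two Lebesgue decompositions of the image of `μ` under the branch
  have e1 : μ.map (branch j) = (μ.singularPart ν).withDensity
      (fun x => ENNReal.ofReal (D.density j x)) +
      ν.withDensity (fun x => ENNReal.ofReal (D.density j x) * p x) := by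
    rw [h.map_branch j, ← hμ]
    conv_lhs => rw [Measure.haveLebesgueDecomposition_add μ ν]
    rw [withDensity_add_measure, ← withDensity_mul _ hpm hd]
    congr 2
    funext x
    exact mul_comm _ _
  have e2 : μ.map (branch j) = (μ.singularPart ν).map (branch j) +
      ν.withDensity (fun x => ENNReal.ofReal (D'.density j x) * p (shift x)) := by
    conv_lhs => rw [Measure.haveLebesgueDecomposition_add μ ν]
    rw [Measure.map_add _ _ (measurable_branch j)]
    congr 1
    ext A hA
    rw [Measure.map_apply (measurable_branch j) hA,
      withDensity_apply _ (measurable_branch j hA), withDensity_apply _ hA]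
    calc ∫⁻ x in branch j ⁻¹' A, p x ∂ν
        = ∫⁻ x in A, p (shift x) ∂(ν.map (branch j)) :=
          (setLIntegral_map hA (hpm.comp measurable_shift) (measurable_branch j)).symm
      _ = _ := by
        rw [h'.map_branch j]
        exact setLIntegral_withDensity_eq_setLIntegral_mul _ hd' (hpm.comp measurable_shift) hA
  have s1 : (μ.singularPart ν).withDensity (fun x => ENNReal.ofReal (D.density j x)) ⟂ₘ ν :=
    (Measure.mutuallySingular_singularPart μ ν).mono_ac (withDensity_absolutelyContinuous _ _)
      Measure.AbsolutelyContinuous.rfl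
  -- The image lives on the preimage of `Sᶜ` under the shift, which is `ν`-null because the shift is
  -- nonsingular for `ν`.
  have s2 : (μ.singularPart ν).map (branch j) ⟂ₘ ν := by
    obtain ⟨S, hS, hS1, hS2⟩ := Measure.mutuallySingular_singularPart μ ν
    refine ⟨shift ⁻¹' S, measurable_shift hS, ?_, ?_⟩
    · rw [Measure.map_apply (measurable_branch j) (measurable_shift hS)]
      exact hS1
    · exact h'.quasiMeasurePreserving_shift.preimage_null hS2
  -- By uniqueness of the Lebesgue decomposition both densities equal the derivative of the image
  -- measure.
  have r1 := Measure.eq_rnDeriv (hd.mul hpm) s1 e1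
  have r2 := Measure.eq_rnDeriv (hd'.mul (hpm.comp measurable_shift)) s2 e2
  filter_upwards [r1, r2] with x hx1 hx2
  exact hx1.trans hx2.symm

/-- The transfer operator intertwines the representations. -/
lemma transfer_intertwines (h : D.IsQuasiStationary) (h' : D'.IsQuasiStationary) (j : Fin N)
    (f : Lp ℂ 2 D.measure) : transfer D.measure D'.measure ((cuntzRep h).S j f) =
      (cuntzRep h').S j (transfer D.measure D'.measure f) := by
  refine Lp.ext ?_
  filter_upwards [transfer_coeFn D.measure D'.measure ((cuntzRep h).S j f),
    sqrtDeriv_mul_congr _ D'.measure (cuntzRep_coeFn h j f),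
    cuntzRep_coeFn h' j (transfer D.measure D'.measure f),
    h'.quasiMeasurePreserving_shift.ae (transfer_coeFn D.measure D'.measure f),
    density_mul_rnDeriv h h' j] with x h1 h2 h3 h4 h5
  rw [h1, h2, h3, h4, ← mul_assoc, ← mul_assoc, ← Complex.ofReal_mul, ← Complex.ofReal_mul]
  congr 2
  have h6 := congrArg ENNReal.toReal h5
  rw [ENNReal.toReal_mul, ENNReal.toReal_mul, ENNReal.toReal_ofReal (h.density_nonneg j x),
    ENNReal.toReal_ofReal (h'.density_nonneg j x)] at h6
  rw [sqrtDeriv, sqrtDeriv, weight, weight, mul_comm, ← Real.sqrt_mul (h.density_nonneg j x), h6,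
    Real.sqrt_mul (h'.density_nonneg j x)]

/-- Disjointness annihilates the transfer operator; its value at the constant function 1 is
`√(dμ/dμ')`, so the absolutely continuous part is zero. -/
lemma mutuallySingular_of_disjoint (h : D.IsQuasiStationary) (h' : D'.IsQuasiStationary)
    (hd : (cuntzRep h).Disjoint (cuntzRep h')) : D.measure ⟂ₘ D'.measure := by
  have h0 := hd.eq_zero_of_intertwines (transfer D.measure D'.measure)
    (transfer_intertwines h h') (isClosed_ker_transfer _ _)
    (norm_transfer_of_mem_orthogonal _ _)
  have h1 : MemLp (fun _ : Words N => (1 : ℂ)) 2 D.measure := memLp_const 1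
  rw [← Measure.rnDeriv_eq_zero]
  have h2 := transfer_coeFn D.measure D'.measure (h1.toLp _)
  rw [h0] at h2
  filter_upwards [h2, sqrtDeriv_mul_congr _ D'.measure h1.coeFn_toLp, Lp.coeFn_zero ℂ 2 D'.measure,
    enorm_sqrtDeriv_sq D.measure D'.measure] with x hx hx' h0 h3
  rw [hx', h0, mul_one] at hx
  rw [← h3, ← hx]
  simp

/-- For `μ ≪ μ'` nothing of the norm is lost. For `μ' ≪ μ` the transfer in the other direction is a
right inverse, by the chain rule `(dμ'/dμ)(dμ/dμ') = 1`. -/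
lemma equivalent_of_absolutelyContinuous (h : D.IsQuasiStationary) (h' : D'.IsQuasiStationary)
    (h1 : D.measure ≪ D'.measure) (h2 : D'.measure ≪ D.measure) :
    (cuntzRep h).Equivalent (cuntzRep h') := by
  have hiso : ∀ f, ‖transfer D.measure D'.measure f‖ = ‖f‖ := by
    intro f
    have h4 : ‖transfer D.measure D'.measure f‖ₑ ^ 2 = ‖f‖ₑ ^ 2 := by
      rw [enorm_transfer_sq, Measure.withDensity_rnDeriv_eq _ _ h1, lintegral_sq_eq]
    have h5 := enorm_eq_of_sq h4
    rw [← ofReal_norm, ← ofReal_norm] at h5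
    rwa [ENNReal.ofReal_eq_ofReal_iff (norm_nonneg _) (norm_nonneg _)] at h5
  have hsurj : Function.Surjective (transfer D.measure D'.measure) := by
    intro g
    refine ⟨transfer D'.measure D.measure g, Lp.ext ?_⟩
    filter_upwards [transfer_coeFn D.measure D'.measure (transfer D'.measure D.measure g),
      h2.ae_le (transfer_coeFn D'.measure D.measure g), Measure.rnDeriv_mul_rnDeriv (κ := D'.measure) h2,
      Measure.rnDeriv_self D'.measure] with x hx hx' h3 h4
    rw [hx, hx', ← mul_assoc, ← Complex.ofReal_mul, sqrtDeriv, sqrtDeriv, ← Real.sqrt_mul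
      ENNReal.toReal_nonneg, ← ENNReal.toReal_mul, mul_comm (D.measure.rnDeriv _ _)]
    rw [Pi.mul_apply, h4] at h3
    rw [h3]
    simp
  let W : Lp ℂ 2 D.measure →ₗᵢ[ℂ] Lp ℂ 2 D'.measure := ⟨transfer D.measure D'.measure, hiso⟩
  exact ⟨LinearIsometryEquiv.ofSurjective W hsurj, transfer_intertwines h h'⟩

end MarkovPair
end CuntzMarkov

namespace CuntzMarkov
namespace MarkovPair

variable {N : ℕ} {D D' : MarkovPair N}

/-! ### Functions of finitely many letters -/

lemma measurable_comap_of_dependsOn {α : Type*} [MeasurableSpace α] {G : Words N → α} {n : ℕ}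
    (hG : DependsOn G (Set.Iic n)) :
    Measurable[MeasurableSpace.comap (Preorder.frestrictLe (π := fun _ : ℕ => Fin N) n)
      inferInstance] G := by
  -- A word is needed to supply the default value `G x₀` of the extension.
  rcases isEmpty_or_nonempty (Words N) with he | ⟨⟨x₀⟩⟩
  · exact fun s _ => ⟨∅, MeasurableSet.empty, Subsingleton.elim _ _⟩
  have h1 : G.FactorsThrough (Preorder.frestrictLe (π := fun _ : ℕ => Fin N) n) := by
    intro x y hxy
    exact hG fun k hk => congrFun hxy ⟨k, Finset.mem_Iic.2 hk⟩
  have h2 : G = Function.extend (Preorder.frestrictLe (π := fun _ : ℕ => Fin N) n) G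
      (fun _ => G x₀) ∘ Preorder.frestrictLe n := (h1.extend_comp _).symm
  rw [h2]
  exact (measurable_of_finite _).comp (comap_measurable _)

lemma measurable_of_dependsOn {α : Type*} [MeasurableSpace α] {G : Words N → α} {n : ℕ}
    (hG : DependsOn G (Set.Iic n)) : Measurable G :=
  (measurable_comap_of_dependsOn hG).mono (Preorder.measurable_frestrictLe n).comap_le le_rfl

lemma withDensity_cyl {ν : Measure (Words N)} {G : Words N → ℝ≥0∞} {n : ℕ}
    (hG : DependsOn G (Set.Iic n)) (y : Words N) :
    ν.withDensity G (cyl y n) = G y * ν (cyl y n) := by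
  rw [withDensity_apply _ (measurableSet_cyl y n), setLIntegral_congr_fun (g := fun _ => G y)
    (measurableSet_cyl y n) fun x hx => hG fun k hk => hx k hk, setLIntegral_const]

/-! ### The likelihood ratio -/

/-- The likelihood ratio `μ'(C(x₁…xₙ₊₁)) / μ(C(x₁…xₙ₊₁))`. -/
noncomputable def likelihood (D D' : MarkovPair N) (n : ℕ) (x : Words N) : ℝ :=
  D'.init (x 0) / D.init (x 0) *
    ∏ k ∈ Finset.range n, D'.trans k (x k) (x (k + 1)) / D.trans k (x k) (x (k + 1))

lemma likelihood_pos (n : ℕ) (x : Words N) : 0 < D.likelihood D' n x :=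
  mul_pos (div_pos (D'.init_pos _) (D.init_pos _))
    (Finset.prod_pos fun _ _ => div_pos (D'.trans_pos _ _ _) (D.trans_pos _ _ _))

lemma dependsOn_likelihood (n : ℕ) : DependsOn (D.likelihood D' n) (Set.Iic n) := by
  intro x y hxy
  rw [likelihood, likelihood, hxy 0 (Nat.zero_le n)]
  congr 1
  refine Finset.prod_congr rfl fun k hk => ?_
  rw [hxy k (Finset.mem_range.1 hk).le, hxy (k + 1) (Finset.mem_range.1 hk)]

lemma limsupRatio_eq (x : Words N) :
    D.limsupRatio D' x = limsup (fun n => ENNReal.ofReal (D.likelihood D' n x)) atTop := by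
  rw [limsupRatio, ← ENNReal.limsup_const_mul_of_ne_top ENNReal.ofReal_ne_top]
  congr 1
  funext n
  rw [likelihood, ENNReal.ofReal_mul (div_pos (D'.init_pos _) (D.init_pos _)).le]

lemma measurable_limsupRatio (D D' : MarkovPair N) : Measurable (D.limsupRatio D') := by
  have h1 : D.limsupRatio D' =
      fun x => limsup (fun n => ENNReal.ofReal (D.likelihood D' n x)) atTop :=
    funext limsupRatio_eq
  rw [h1]
  exact Measurable.limsup fun n =>
    (measurable_of_dependsOn (dependsOn_likelihood n)).ennreal_ofReal

lemma measure_cyl_eq_likelihood_mul (n : ℕ) (y : Words N) : D'.measure (cyl y n) =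
    ENNReal.ofReal (D.likelihood D' n y) * D.measure (cyl y n) := by
  rw [measure_cyl, measure_cyl, ← ENNReal.ofReal_mul (likelihood_pos n y).le, likelihood,
    Finset.prod_div_distrib]
  congr 1
  have h1 := (D.init_pos (y 0)).ne'
  have h2 : ∏ k ∈ Finset.range n, D.trans k (y k) (y (k + 1)) ≠ 0 :=
    (Finset.prod_pos fun k _ => D.trans_pos k _ _).ne'
  field_simp

/-- The sum `μ + μ'` dominates both measures even when they are singular, and the share of `μ` in it
on a cylinder, `1 / (1 + Zₙ)`, stays bounded. -/
lemma withDensity_inv_one_add_likelihood_cyl (n : ℕ) (y : Words N) :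
    (D.measure + D'.measure).withDensity
      (fun x => ENNReal.ofReal (1 + D.likelihood D' n x)⁻¹) (cyl y n) = D.measure (cyl y n) := by
  have h0 : 0 < 1 + D.likelihood D' n y := add_pos one_pos (likelihood_pos n y)
  rw [withDensity_cyl fun x z hxz => by rw [dependsOn_likelihood n hxz], Measure.add_apply,
    measure_cyl_eq_likelihood_mul (D := D) (D' := D')]
  have h1 : D.measure (cyl y n) + ENNReal.ofReal (D.likelihood D' n y) * D.measure (cyl y n) =
      ENNReal.ofReal (1 + D.likelihood D' n y) * D.measure (cyl y n) := by
    rw [ENNReal.ofReal_add zero_le_one (likelihood_pos n y).le, add_mul, ENNReal.ofReal_one,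
      one_mul]
  rw [h1, ← mul_assoc, ← ENNReal.ofReal_mul (inv_pos.2 h0).le, inv_mul_cancel₀ h0.ne',
    ENNReal.ofReal_one, one_mul]

/-! ### Martingale convergence of the likelihood ratio -/

instance (D D' : MarkovPair N) :
    D.measure.HaveLebesgueDecomposition (D.measure + D'.measure) :=
  Measure.haveLebesgueDecomposition_of_sigmaFinite _ _

instance (D D' : MarkovPair N) :
    D'.measure.HaveLebesgueDecomposition (D.measure + D'.measure) :=
  Measure.haveLebesgueDecomposition_of_sigmaFinite _ _

lemma absolutelyContinuous_add_left : D.measure ≪ D.measure + D'.measure :=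
  Measure.absolutelyContinuous_of_le (Measure.le_add_right le_rfl)

lemma absolutelyContinuous_add_right : D'.measure ≪ D.measure + D'.measure :=
  Measure.absolutelyContinuous_of_le (Measure.le_add_left le_rfl)

lemma inv_one_add_likelihood_eq_condExp (n : ℕ) :
    (fun x => (1 + D.likelihood D' n x)⁻¹) =ᵐ[D.measure + D'.measure]
      (D.measure + D'.measure)[fun x => (D.measure.rnDeriv (D.measure + D'.measure) x).toReal |
        Filtration.piLE (X := fun _ : ℕ => Fin N) n] := by
  have hdep : DependsOn (fun x => (1 + D.likelihood D' n x)⁻¹) (Set.Iic n) :=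
    fun x z hxz => by simp only [dependsOn_likelihood n hxz]
  have hmeas := measurable_of_dependsOn hdep
  have hpos : ∀ x, 0 ≤ (1 + D.likelihood D' n x)⁻¹ := fun x =>
    (inv_pos.2 (add_pos one_pos (likelihood_pos n x))).le
  have hint : Integrable (fun x => (1 + D.likelihood D' n x)⁻¹) (D.measure + D'.measure) := by
    refine Integrable.of_bound hmeas.aestronglyMeasurable 1 (ae_of_all _ fun x => ?_)
    rw [Real.norm_of_nonneg (hpos x)]
    exact inv_le_one_of_one_le₀ (by linarith [likelihood_pos (D := D) (D' := D') n x])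
  refine ae_eq_condExp_of_forall_setIntegral_eq (Filtration.piLE.le n)
    Measure.integrable_toReal_rnDeriv (fun s _ _ => hint.integrableOn) (fun s hs _ => ?_) ?_
  · have hs' := Filtration.piLE.le n s hs
    rw [Measure.setIntegral_toReal_rnDeriv absolutelyContinuous_add_left,
      integral_eq_lintegral_of_nonneg_ae (ae_of_all _ hpos) hmeas.aestronglyMeasurable,
      ← withDensity_apply _ hs', measureReal_def]
    congr 1
    rw [Filtration.piLE_eq_comap_frestrictLe] at hs
    obtain ⟨B, hB, rfl⟩ := hs
    rw [← Measure.map_apply (Preorder.measurable_frestrictLe n) hB,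
      ← Measure.map_apply (Preorder.measurable_frestrictLe n) hB,
      map_eq_of_cyl (withDensity_inv_one_add_likelihood_cyl n)]
  · rw [Filtration.piLE_eq_comap_frestrictLe]
    exact (measurable_comap_of_dependsOn hdep).stronglyMeasurable.aestronglyMeasurable

/-- The letters generate the whole σ-algebra, so the martingale limit is the density itself and not
merely a conditional expectation of it. -/
lemma le_iSup_piLE : (inferInstance : MeasurableSpace (Words N)) ≤
    ⨆ n, Filtration.piLE (X := fun _ : ℕ => Fin N) n := by
  refine iSup_le fun k => ?_
  refine le_trans ?_ (le_iSup _ k)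
  rw [Filtration.piLE_eq_comap_frestrictLe]
  have h1 : Measurable[MeasurableSpace.comap (Preorder.frestrictLe (π := fun _ : ℕ => Fin N) k)
      inferInstance] fun x : Words N => x k :=
    measurable_comap_of_dependsOn fun x y hxy => hxy k (Set.mem_Iic.2 le_rfl)
  exact h1.comap_le

lemma tendsto_inv_one_add_likelihood : ∀ᵐ x ∂(D.measure + D'.measure),
    Tendsto (fun n => (1 + D.likelihood D' n x)⁻¹) atTop
      (𝓝 (D.measure.rnDeriv (D.measure + D'.measure) x).toReal) := by
  have h1 := Integrable.tendsto_ae_condExp (μ := D.measure + D'.measure)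
    (ℱ := Filtration.piLE (X := fun _ : ℕ => Fin N))
    (g := fun x => (D.measure.rnDeriv (D.measure + D'.measure) x).toReal)
    Measure.integrable_toReal_rnDeriv
    (((Measure.measurable_rnDeriv _ _).ennreal_toReal.mono le_iSup_piLE le_rfl).stronglyMeasurable)
  filter_upwards [h1, ae_all_iff.2 inv_one_add_likelihood_eq_condExp] with x hx hx'
  exact hx.congr fun n => (hx' n).symm

/-- The set where `Z_∞` is infinite or zero, in terms of Radon–Nikodym derivatives. -/
lemma limsupRatio_eq_top_iff_and_eq_zero_iff : ∀ᵐ x ∂(D.measure + D'.measure),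
    (D.limsupRatio D' x = ∞ ↔ D.measure.rnDeriv (D.measure + D'.measure) x = 0) ∧
    (D.limsupRatio D' x = 0 ↔ D'.measure.rnDeriv (D.measure + D'.measure) x = 0) := by
  filter_upwards [tendsto_inv_one_add_likelihood (D := D) (D' := D'),
    Measure.rnDeriv_lt_top D.measure (D.measure + D'.measure),
    Measure.rnDeriv_add D.measure D'.measure (D.measure + D'.measure),
    Measure.rnDeriv_self (D.measure + D'.measure)] with x hx htop hadd hself
  -- The two densities with respect to `μ + μ'` add up to 1.
  rw [hself, Pi.add_apply] at hadd
  set p := D.measure.rnDeriv (D.measure + D'.measure) x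
  set p' := D'.measure.rnDeriv (D.measure + D'.measure) x
  rw [limsupRatio_eq]
  have hZ : ∀ n, ENNReal.ofReal (D.likelihood D' n x) =
      ENNReal.ofReal (((1 + D.likelihood D' n x)⁻¹)⁻¹ - 1) := fun n => by
    rw [inv_inv, add_sub_cancel_left]
  simp only [hZ]
  rcases eq_or_ne p 0 with hp | hp
  · rw [hp, ENNReal.toReal_zero] at hx
    -- Positivity makes the approach to 0 one-sided, so the inverses tend to `+∞`.
    have h1 : Tendsto (fun n => (1 + D.likelihood D' n x)⁻¹) atTop (𝓝[>] 0) :=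
      tendsto_nhdsWithin_iff.2 ⟨hx, Eventually.of_forall fun n =>
        inv_pos.2 (add_pos one_pos (likelihood_pos n x))⟩
    have h2 := ENNReal.tendsto_ofReal_atTop.comp
      (tendsto_atTop_add_const_right _ (-1) (tendsto_inv_nhdsGT_zero.comp h1))
    have h3 := h2.limsup_eq
    simp only [Function.comp_def, ← sub_eq_add_neg] at h3
    rw [h3, hp]
    rw [hp, zero_add] at hadd
    simp [← hadd]
  · have hp0 : 0 < p.toReal := ENNReal.toReal_pos hp htop.ne
    have h1 := (ENNReal.tendsto_ofReal ((hx.inv₀ hp0.ne').sub_const 1)).limsup_eq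
    rw [h1]
    refine ⟨by simp [hp], ?_⟩
    -- Here `Z_∞ = 1/p - 1`, which is zero in `[0, ∞]` exactly when `p ≥ 1`, that is, when `p' = 1 -
    -- p` is zero.
    rw [ENNReal.ofReal_eq_zero, sub_nonpos, inv_le_one₀ hp0]
    constructor
    · intro h2
      have h3 : 1 ≤ p := by
        rw [← ENNReal.ofReal_one, ← ENNReal.ofReal_toReal htop.ne]
        exact ENNReal.ofReal_le_ofReal h2
      have h4 : p + p' ≤ p + 0 := by
        rw [← hadd, add_zero]
        exact h3
      exact nonpos_iff_eq_zero.1 ((ENNReal.add_le_add_iff_left htop.ne).1 h4)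
    · intro h2
      rw [h2, add_zero] at hadd
      rw [← hadd, ENNReal.toReal_one]

/-! ### Absolute continuity and singularity in terms of `Z_∞` -/

lemma ae_limsupRatio_ne_top : ∀ᵐ x ∂D.measure, D.limsupRatio D' x ≠ ∞ := by
  filter_upwards [absolutelyContinuous_add_left.ae_le
    (limsupRatio_eq_top_iff_and_eq_zero_iff (D := D) (D' := D')),
    Measure.rnDeriv_pos (absolutelyContinuous_add_left (D := D) (D' := D'))] with x hx hx'
  rw [Ne, hx.1]
  exact hx'.ne'

lemma ae_limsupRatio_ne_zero : ∀ᵐ x ∂D'.measure, D.limsupRatio D' x ≠ 0 := by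
  filter_upwards [absolutelyContinuous_add_right.ae_le
    (limsupRatio_eq_top_iff_and_eq_zero_iff (D := D) (D' := D')),
    Measure.rnDeriv_pos (absolutelyContinuous_add_right (D := D) (D' := D'))] with x hx hx'
  rw [Ne, hx.2]
  exact hx'.ne'

lemma ae_rnDeriv_eq_zero_of_null {Ω : Type*} [MeasurableSpace Ω] {μ ν : Measure Ω}
    {S : Set Ω} (hS : μ S = 0) : ∀ᵐ x ∂ν, x ∈ S → μ.rnDeriv ν x = 0 := by
  have h1 : ∀ᵐ x ∂(ν.withDensity (μ.rnDeriv ν)), x ∉ S :=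
    (Measure.absolutelyContinuous_of_le (Measure.withDensity_rnDeriv_le μ ν)).ae_le
      (measure_eq_zero_iff_ae_notMem.1 hS)
  rw [ae_withDensity_iff (Measure.measurable_rnDeriv μ ν)] at h1
  filter_upwards [h1] with x hx hxS
  by_contra h2
  exact hx h2 hxS

/-- On the set where `Z_∞` is finite, `μ'` is absolutely continuous with respect to `μ`. -/
lemma ae_limsupRatio_eq_top_of_null {S : Set (Words N)} (hS : D.measure S = 0) :
    ∀ᵐ x ∂D'.measure, x ∈ S → D.limsupRatio D' x = ∞ := by
  refine absolutelyContinuous_add_right.ae_le (ν := D.measure + D'.measure) ?_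
  filter_upwards [limsupRatio_eq_top_iff_and_eq_zero_iff (D := D) (D' := D'),
    ae_rnDeriv_eq_zero_of_null hS] with x hx hx' hxS
  exact hx.1.2 (hx' hxS)

/-- On the set where `Z_∞` is positive, `μ` is absolutely continuous with respect to `μ'`. -/
lemma ae_limsupRatio_eq_zero_of_null {S : Set (Words N)} (hS : D'.measure S = 0) :
    ∀ᵐ x ∂D.measure, x ∈ S → D.limsupRatio D' x = 0 := by
  refine absolutelyContinuous_add_left.ae_le (ν := D.measure + D'.measure) ?_
  filter_upwards [limsupRatio_eq_top_iff_and_eq_zero_iff (D := D) (D' := D'),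
    ae_rnDeriv_eq_zero_of_null hS] with x hx hx' hxS
  exact hx.2.2 (hx' hxS)

lemma absolutelyContinuous_iff_ae_lt_top :
    D'.measure ≪ D.measure ↔ ∀ᵐ x ∂D'.measure, D.limsupRatio D' x < ∞ := by
  constructor
  · intro h
    filter_upwards [h.ae_le (ae_limsupRatio_ne_top (D := D) (D' := D'))] with x hx
    exact hx.lt_top
  · intro h S hS
    rw [measure_eq_zero_iff_ae_notMem]
    filter_upwards [h, ae_limsupRatio_eq_top_of_null (D' := D') hS] with x hx hx' hxS
    exact hx.ne (hx' hxS)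

lemma absolutelyContinuous_iff_ae_pos :
    D.measure ≪ D'.measure ↔ ∀ᵐ x ∂D.measure, 0 < D.limsupRatio D' x := by
  constructor
  · intro h
    filter_upwards [h.ae_le (ae_limsupRatio_ne_zero (D := D) (D' := D'))] with x hx
    exact pos_iff_ne_zero.2 hx
  · intro h S hS
    rw [measure_eq_zero_iff_ae_notMem]
    filter_upwards [h, ae_limsupRatio_eq_zero_of_null (D := D) hS] with x hx hx' hxS
    exact hx.ne' (hx' hxS)

lemma mutuallySingular_iff_ae_eq_top :
    D.measure ⟂ₘ D'.measure ↔ ∀ᵐ x ∂D'.measure, D.limsupRatio D' x = ∞ := by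
  constructor
  · rintro ⟨S, -, hS1, hS2⟩
    filter_upwards [ae_limsupRatio_eq_top_of_null (D' := D') hS1,
      measure_eq_zero_iff_ae_notMem.1 hS2] with x hx hx'
    exact hx (by simpa using hx')
  · intro h
    -- The set where `Z_∞` is infinite is always `μ`-null, so it separates the measures once it has
    -- full `μ'`-measure.
    refine ⟨{x | D.limsupRatio D' x = ∞},
      measurable_limsupRatio D D' (measurableSet_singleton _), ?_, h⟩
    have h1 := ae_limsupRatio_ne_top (D := D) (D' := D')
    rw [ae_iff] at h1
    simpa using h1

lemma mutuallySingular_iff_ae_eq_zero :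
    D.measure ⟂ₘ D'.measure ↔ ∀ᵐ x ∂D.measure, D.limsupRatio D' x = 0 := by
  constructor
  · rintro ⟨S, -, hS1, hS2⟩
    filter_upwards [ae_limsupRatio_eq_zero_of_null (D := D) hS2,
      measure_eq_zero_iff_ae_notMem.1 hS1] with x hx hx'
    exact hx hx'
  · intro h
    refine Measure.MutuallySingular.symm ⟨{x | D.limsupRatio D' x = 0},
      measurable_limsupRatio D D' (measurableSet_singleton _), ?_, h⟩
    have h1 := ae_limsupRatio_ne_zero (D := D) (D' := D')
    rw [ae_iff] at h1
    simpa using h1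

end MarkovPair
end CuntzMarkov

/-! ### Conditional expectations along the Markov chain -/

namespace CuntzMarkov
namespace MarkovPair

variable {N : ℕ} {D D' : MarkovPair N}

lemma lintegral_letterMeasure (p : Fin N → ℝ) (f : Fin N → ℝ≥0∞) :
    ∫⁻ j, f j ∂(letterMeasure p) = ∑ j, ENNReal.ofReal (p j) * f j := by
  rw [letterMeasure, lintegral_finsetSum_measure]
  simp

/-- The Markov property: the expectation over the letter with index `n + 1`, given the letters with
indices `0, …, n`. -/
lemma lintegral_mul_transition (D : MarkovPair N) {n : ℕ} {G : Words N → ℝ≥0∞}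
    (hG : DependsOn G (Set.Iic n)) (φ : Fin N → Fin N → ℝ≥0∞) :
    ∫⁻ x, G x * φ (x n) (x (n + 1)) ∂D.measure =
      ∫⁻ x, G x * ∑ j, ENNReal.ofReal (D.trans n (x n) j) * φ (x n) j ∂D.measure := by
  have hp := isProbabilityMeasure_letterMeasure D.init_pos D.init_sum
  have h1 : G.FactorsThrough (Preorder.frestrictLe (π := fun _ : ℕ => Fin N) n) := by
    intro x y hxy
    exact hG fun k hk => congrFun hxy ⟨k, Finset.mem_Iic.2 hk⟩
  set g := Function.extend (Preorder.frestrictLe (π := fun _ : ℕ => Fin N) n) G (fun _ => 0)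
  have h2 : ∀ x, G x = g (Preorder.frestrictLe n x) := fun x => (h1.extend_apply _ x).symm
  let e : Finset.Iic n := ⟨n, Finset.mem_Iic.2 le_rfl⟩
  have h3 := Kernel.map_frestrictLe_trajMeasure_compProd_eq_map_trajMeasure
    (X := fun _ => Fin N) (μ₀ := letterMeasure D.init) (κ := D.kernel) (a := n)
  change Measure.map _ D.measure ⊗ₘ _ = Measure.map _ D.measure at h3
  have hm : Measurable fun x : Words N =>
      (Preorder.frestrictLe (π := fun _ => Fin N) n x, x (n + 1)) := by fun_prop
  have hF : Measurable fun q : (∀ _ : Finset.Iic n, Fin N) × Fin N => g q.1 * φ (q.1 e) q.2 :=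
    measurable_of_finite _
  calc ∫⁻ x, G x * φ (x n) (x (n + 1)) ∂D.measure
      = ∫⁻ q : (∀ _ : Finset.Iic n, Fin N) × Fin N, g q.1 * φ (q.1 e) q.2
          ∂(D.measure.map fun x : Words N =>
            (Preorder.frestrictLe (π := fun _ => Fin N) n x, x (n + 1))) := by
        rw [lintegral_map hF hm]
        exact lintegral_congr fun x => by rw [h2]; rfl
    _ = ∫⁻ a, g a * ∑ j, ENNReal.ofReal (D.trans n (a e) j) * φ (a e) j
          ∂(D.measure.map (Preorder.frestrictLe (π := fun _ => Fin N) n)) := by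
        rw [← h3, Measure.lintegral_compProd hF]
        refine lintegral_congr fun a => ?_
        exact (lintegral_const_mul (g a) (measurable_of_finite _)).trans
          (congrArg (g a * ·) (lintegral_letterMeasure _ _))
    _ = _ := by
        rw [lintegral_map (measurable_of_finite _) (Preorder.measurable_frestrictLe n)]
        exact lintegral_congr fun x => by rw [h2]; rfl

open scoped Classical in
/-- Products of conditionally normalized factors that are switched on by predictable conditions
have expectation one. -/
lemma lintegral_prod_predictable (D : MarkovPair N) (g : ℕ → Fin N → Fin N → ℝ≥0∞)
    (hg : ∀ k i, ∑ j, ENNReal.ofReal (D.trans k i j) * g k i j = 1)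
    (C : ℕ → Words N → Prop) (hC : ∀ k, DependsOn (C k) (Set.Iic k)) (n : ℕ) :
    ∫⁻ x, ∏ k ∈ Finset.range n, (if C k x then g k (x k) (x (k + 1)) else 1) ∂D.measure = 1 := by
  induction n with
  | zero => simp
  | succ n ih =>
    set G : Words N → ℝ≥0∞ :=
      fun x => ∏ k ∈ Finset.range n, (if C k x then g k (x k) (x (k + 1)) else 1) with hGdef
    have hG : DependsOn G (Set.Iic n) := by
      intro x y hxy
      refine Finset.prod_congr rfl fun k hk => ?_
      have hk' := Finset.mem_range.1 hk
      rw [hxy k hk'.le, hxy (k + 1) hk',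
        hC k fun i hi => hxy i (le_trans hi hk'.le)]
    -- The condition `C n` is decided before letter `n + 1` appears. Splitting along it leaves the
    -- new factor multiplied only by a function of the letters up to `n`, and the factor then
    -- averages to 1.
    have hG1 : DependsOn (fun x => if C n x then G x else 0) (Set.Iic n) :=
      fun x y hxy => by simp only [hG hxy, hC n hxy]
    have hG2 : DependsOn (fun x => if C n x then 0 else G x) (Set.Iic n) :=
      fun x y hxy => by simp only [hG hxy, hC n hxy]
    calc ∫⁻ x, ∏ k ∈ Finset.range (n + 1), (if C k x then g k (x k) (x (k + 1)) else 1) ∂D.measure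
        = ∫⁻ x, ((if C n x then G x else 0) * g n (x n) (x (n + 1)) +
            (if C n x then 0 else G x)) ∂D.measure := by
          refine lintegral_congr fun x => ?_
          rw [Finset.prod_range_succ]
          split_ifs <;> simp [hGdef]
      _ = ∫⁻ x, ((if C n x then G x else 0) + (if C n x then 0 else G x)) ∂D.measure := by
          rw [lintegral_add_right _ (measurable_of_dependsOn hG2), lintegral_mul_transition D hG1,
            lintegral_add_right _ (measurable_of_dependsOn hG2)]
          simp only [hg, mul_one]
      _ = ∫⁻ x, G x ∂D.measure := lintegral_congr fun x => by split_ifs <;> simp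
      _ = 1 := ih

/-! ### Hellinger affinities -/

/-- The Hellinger affinity of the `i`-th rows of the `n`-th transition matrices. -/
noncomputable def affinity (D D' : MarkovPair N) (n : ℕ) (i : Fin N) : ℝ :=
  ∑ j, √(D'.trans n i j) * √(D.trans n i j)

/-- The square roots `√(T⁽ⁿ⁾(i,j) / T'⁽ⁿ⁾(i,j))`. -/
noncomputable def sqrtRatio (D D' : MarkovPair N) (n : ℕ) (i j : Fin N) : ℝ :=
  √(D.trans n i j / D'.trans n i j)

lemma sqrtRatio_pos (n : ℕ) (i j : Fin N) : 0 < D.sqrtRatio D' n i j :=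
  Real.sqrt_pos.2 (div_pos (D.trans_pos _ _ _) (D'.trans_pos _ _ _))

lemma sqrtRatio_sq (n : ℕ) (i j : Fin N) :
    D.sqrtRatio D' n i j ^ 2 = D.trans n i j / D'.trans n i j :=
  Real.sq_sqrt (div_pos (D.trans_pos _ _ _) (D'.trans_pos _ _ _)).le

lemma affinity_pos (n : ℕ) (i : Fin N) : 0 < D.affinity D' n i :=
  Finset.sum_pos (fun _ _ => mul_pos (Real.sqrt_pos.2 (D'.trans_pos _ _ _))
    (Real.sqrt_pos.2 (D.trans_pos _ _ _))) ⟨i, Finset.mem_univ i⟩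

/-- Arithmetic–geometric mean inequality, entry by entry, and row sums equal to 1. -/
lemma affinity_le_one (n : ℕ) (i : Fin N) : D.affinity D' n i ≤ 1 := by
  have h1 : ∀ j, √(D'.trans n i j) * √(D.trans n i j) ≤
      (D'.trans n i j + D.trans n i j) / 2 := by
    intro j
    have h2 := Real.sq_sqrt (D'.trans_pos n i j).le
    have h3 := Real.sq_sqrt (D.trans_pos n i j).le
    nlinarith [sq_nonneg (√(D'.trans n i j) - √(D.trans n i j))]
  refine (Finset.sum_le_sum fun j _ => h1 j).trans ?_
  rw [← Finset.sum_div, Finset.sum_add_distrib, D.trans_sum, D'.trans_sum]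
  norm_num

lemma hellingerTerm_eq (x : Words N) (n : ℕ) :
    D.hellingerTerm D' x n = 1 - D.affinity D' n (x n) := rfl

lemma hellingerTerm_nonneg (x : Words N) (n : ℕ) : 0 ≤ D.hellingerTerm D' x n :=
  sub_nonneg.2 (affinity_le_one _ _)

lemma hellingerTerm_comm (D D' : MarkovPair N) : D.hellingerTerm D' = D'.hellingerTerm D := by
  funext x n
  simp only [hellingerTerm, mul_comm]

/-- Since `T' · (T/T') = T`, squared ratios are normalized factors in the sense of
`lintegral_prod_predictable`. -/
lemma sum_mul_sqrtRatio_sq (n : ℕ) (i : Fin N) :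
    ∑ j, ENNReal.ofReal (D'.trans n i j) * ENNReal.ofReal (D.sqrtRatio D' n i j ^ 2) = 1 := by
  have h1 : ∀ j, ENNReal.ofReal (D'.trans n i j) * ENNReal.ofReal (D.sqrtRatio D' n i j ^ 2) =
      ENNReal.ofReal (D.trans n i j) := fun j => by
    rw [← ENNReal.ofReal_mul (D'.trans_pos _ _ _).le, sqrtRatio_sq,
      mul_div_cancel₀ _ (D'.trans_pos _ _ _).ne']
  simp only [h1]
  rw [← ENNReal.ofReal_sum_of_nonneg fun j _ => (D.trans_pos _ _ _).le, D.trans_sum,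
    ENNReal.ofReal_one]

/-- Since `T' √(T/T') = √T' √T`, the conditional mean of the ratio is the affinity; dividing by it
gives a second family of normalized factors. -/
lemma sum_mul_sqrtRatio_div (n : ℕ) (i : Fin N) :
    ∑ j, ENNReal.ofReal (D'.trans n i j) *
      ENNReal.ofReal (D.sqrtRatio D' n i j / D.affinity D' n i) = 1 := by
  have h1 : ∀ j, ENNReal.ofReal (D'.trans n i j) *
      ENNReal.ofReal (D.sqrtRatio D' n i j / D.affinity D' n i) =
      ENNReal.ofReal (√(D'.trans n i j) * √(D.trans n i j) / D.affinity D' n i) := fun j => by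
    rw [← ENNReal.ofReal_mul (D'.trans_pos _ _ _).le, sqrtRatio, Real.sqrt_div
      (D.trans_pos _ _ _).le]
    congr 1
    have h2 := (Real.sqrt_pos.2 (D'.trans_pos n i j)).ne'
    calc D'.trans n i j * (√(D.trans n i j) / √(D'.trans n i j) / D.affinity D' n i)
        = √(D'.trans n i j) * √(D'.trans n i j) *
          (√(D.trans n i j) / √(D'.trans n i j) / D.affinity D' n i) := by
          rw [Real.mul_self_sqrt (D'.trans_pos n i j).le]
      _ = _ := by field_simp
  simp only [h1]
  rw [← ENNReal.ofReal_sum_of_nonneg fun j _ => div_nonneg (mul_nonneg (Real.sqrt_nonneg _)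
    (Real.sqrt_nonneg _)) (affinity_pos _ _).le, ← Finset.sum_div]
  change ENNReal.ofReal (D.affinity D' n i / D.affinity D' n i) = 1
  rw [div_self (affinity_pos n i).ne', ENNReal.ofReal_one]

lemma one_sub_sum_le_prod {ι : Type*} (s : Finset ι) (f : ι → ℝ) (h0 : ∀ i, 0 ≤ f i)
    (h1 : ∀ i, f i ≤ 1) : 1 - ∑ i ∈ s, (1 - f i) ≤ ∏ i ∈ s, f i := by
  classical
  induction s using Finset.induction_on with
  | empty => simp
  | insert a s ha ih =>
    rw [Finset.sum_insert ha, Finset.prod_insert ha]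
    have h2 : ∏ i ∈ s, f i ≤ 1 := Finset.prod_le_one (fun i _ => h0 i) fun i _ => h1 i
    nlinarith [h0 a, h1 a]

open scoped Classical in
/-- The probability that a predictably stopped product of the square roots of the transition
ratios is small is bounded by the stopped Hellinger sum. -/
lemma measure_prod_lt_half_le (C : ℕ → Words N → Prop) (hC : ∀ k, DependsOn (C k) (Set.Iic k))
    {n : ℕ} {ε : ℝ} (hε : ε ≤ 1)
    (hsum : ∀ x, ∑ k ∈ Finset.range n, (if C k x then D.hellingerTerm D' x k else 0) ≤ ε) :
    D'.measure {x | ∏ k ∈ Finset.range n,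
      (if C k x then D.sqrtRatio D' k (x k) (x (k + 1)) else 1) < 1 / 2} ≤
      ENNReal.ofReal (8 * ε) := by
  set P : Words N → ℝ := fun x => ∏ k ∈ Finset.range n,
    (if C k x then D.sqrtRatio D' k (x k) (x (k + 1)) else 1) with hP
  have hP0 : ∀ x, 0 ≤ P x := fun x => Finset.prod_nonneg fun k _ => by
    split_ifs
    exacts [(sqrtRatio_pos _ _ _).le, zero_le_one]
  have hPdep : DependsOn P (Set.Iic n) := by
    intro x y hxy
    refine Finset.prod_congr rfl fun k hk => ?_
    have hk' := Finset.mem_range.1 hk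
    rw [hxy k hk'.le, hxy (k + 1) hk', hC k fun i hi => hxy i (le_trans hi hk'.le)]
  have hPm : Measurable P := measurable_of_dependsOn hPdep
  have hsq : ∫⁻ x, ENNReal.ofReal (P x ^ 2) ∂D'.measure = 1 := by
    rw [← lintegral_prod_predictable D' (fun k i j => ENNReal.ofReal (D.sqrtRatio D' k i j ^ 2))
      sum_mul_sqrtRatio_sq C hC n]
    refine lintegral_congr fun x => ?_
    rw [hP, ← Finset.prod_pow, ENNReal.ofReal_prod_of_nonneg fun k _ => sq_nonneg _]
    refine Finset.prod_congr rfl fun k _ => ?_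
    split_ifs <;> simp
  -- `P` is the stopped product of affinities times a product of mean 1. The former is at least 1
  -- minus the stopped Hellinger sum, at every word.
  have hone : ENNReal.ofReal (1 - ε) ≤ ∫⁻ x, ENNReal.ofReal (P x) ∂D'.measure := by
    have h1 := lintegral_prod_predictable D'
      (fun k i j => ENNReal.ofReal (D.sqrtRatio D' k i j / D.affinity D' k i))
      sum_mul_sqrtRatio_div C hC n
    calc ENNReal.ofReal (1 - ε) = ENNReal.ofReal (1 - ε) * 1 := (mul_one _).symm
      _ = ∫⁻ x, ENNReal.ofReal (1 - ε) * ∏ k ∈ Finset.range n, (if C k x then ENNReal.ofReal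
            (D.sqrtRatio D' k (x k) (x (k + 1)) / D.affinity D' k (x k)) else 1)
            ∂D'.measure := by
          rw [lintegral_const_mul', h1]
          exact ENNReal.ofReal_ne_top
      _ ≤ _ := by
          refine lintegral_mono fun x => ?_
          have h2 : ∏ k ∈ Finset.range n, (if C k x then ENNReal.ofReal
              (D.sqrtRatio D' k (x k) (x (k + 1)) / D.affinity D' k (x k)) else 1) =
              ENNReal.ofReal (∏ k ∈ Finset.range n, (if C k x then
                D.sqrtRatio D' k (x k) (x (k + 1)) / D.affinity D' k (x k) else 1)) := by
            rw [ENNReal.ofReal_prod_of_nonneg]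
            · refine Finset.prod_congr rfl fun k _ => ?_
              split_ifs <;> simp
            · intro k _
              split_ifs
              exacts [div_nonneg (sqrtRatio_pos _ _ _).le (affinity_pos _ _).le, zero_le_one]
          have h3 : P x = (∏ k ∈ Finset.range n, (if C k x then D.affinity D' k (x k) else 1)) *
              ∏ k ∈ Finset.range n, (if C k x then
                D.sqrtRatio D' k (x k) (x (k + 1)) / D.affinity D' k (x k) else 1) := by
            rw [← Finset.prod_mul_distrib]
            refine Finset.prod_congr rfl fun k _ => ?_
            split_ifs
            · rw [mul_div_cancel₀ _ (affinity_pos _ _).ne']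
            · rw [mul_one]
          have h4 : 1 - ε ≤ ∏ k ∈ Finset.range n, (if C k x then D.affinity D' k (x k) else 1) := by
            refine le_trans ?_ (one_sub_sum_le_prod _ _ (fun k => ?_) fun k => ?_)
            · have h5 : ∀ k, 1 - (if C k x then D.affinity D' k (x k) else 1) =
                  if C k x then D.hellingerTerm D' x k else 0 := fun k => by
                split_ifs
                · rfl
                · exact sub_self 1
              simp only [h5]
              linarith [hsum x]
            · split_ifs
              exacts [(affinity_pos _ _).le, zero_le_one]
            · split_ifs
              exacts [affinity_le_one _ _, le_rfl]
          rw [h2, ← ENNReal.ofReal_mul (by linarith), h3]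
          refine ENNReal.ofReal_le_ofReal (mul_le_mul_of_nonneg_right h4 ?_)
          refine Finset.prod_nonneg fun k _ => ?_
          split_ifs
          exacts [div_nonneg (sqrtRatio_pos _ _ _).le (affinity_pos _ _).le, zero_le_one]
  have hS : MeasurableSet {x | P x < 1 / 2} := hPm measurableSet_Iio
  -- Chebyshev's inequality for `(1 - P)²`: pointwise `2P + (1/4) 1_{P < 1/2} ≤ P² + 1`. Integrating
  -- with mean square 1 and mean at least `1 - ε` yields the constant 8.
  have hkey : 2 * ENNReal.ofReal (1 - ε) + ENNReal.ofReal (1 / 4) *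
      D'.measure {x | P x < 1 / 2} ≤ 2 := by
    calc 2 * ENNReal.ofReal (1 - ε) + ENNReal.ofReal (1 / 4) * D'.measure {x | P x < 1 / 2}
        ≤ 2 * ∫⁻ x, ENNReal.ofReal (P x) ∂D'.measure +
          ∫⁻ x, {x | P x < 1 / 2}.indicator (fun _ => ENNReal.ofReal (1 / 4)) x ∂D'.measure := by
          rw [lintegral_indicator_const hS]
          gcongr
      _ = ∫⁻ x, (2 * ENNReal.ofReal (P x) +
          {x | P x < 1 / 2}.indicator (fun _ => ENNReal.ofReal (1 / 4)) x) ∂D'.measure := by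
          rw [lintegral_add_right _ (measurable_const.indicator hS),
            lintegral_const_mul' _ _ (by simp)]
      _ ≤ ∫⁻ x, (ENNReal.ofReal (P x ^ 2) + 1) ∂D'.measure := by
          refine lintegral_mono fun x => ?_
          have e1 : (2 : ℝ≥0∞) = ENNReal.ofReal 2 := by simp
          have e2 : (1 : ℝ≥0∞) = ENNReal.ofReal 1 := by simp
          dsimp only
          rw [e1, e2, ← ENNReal.ofReal_mul zero_le_two,
            ← ENNReal.ofReal_add (sq_nonneg _) zero_le_one]
          by_cases hx : P x < 1 / 2
          · rw [Set.indicator_of_mem (show x ∈ {x | P x < 1 / 2} from hx),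
              ← ENNReal.ofReal_add (mul_nonneg zero_le_two (hP0 x)) (by norm_num)]
            exact ENNReal.ofReal_le_ofReal (by nlinarith)
          · rw [Set.indicator_of_notMem (show x ∉ {x | P x < 1 / 2} from hx), add_zero]
            exact ENNReal.ofReal_le_ofReal (by nlinarith [sq_nonneg (P x - 1)])
      _ = 2 := by
          rw [lintegral_add_right _ measurable_const, hsq]
          simp [one_add_one_eq_two]
  have hfin : D'.measure {x | P x < 1 / 2} ≠ ∞ := measure_ne_top _ _
  have h6 := ENNReal.toReal_mono (by simp) hkey
  rw [ENNReal.toReal_add (ENNReal.mul_ne_top (by simp) ENNReal.ofReal_ne_top)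
    (ENNReal.mul_ne_top ENNReal.ofReal_ne_top hfin), ENNReal.toReal_mul, ENNReal.toReal_mul,
    ENNReal.toReal_ofReal (by linarith), ENNReal.toReal_ofReal (by norm_num)] at h6
  simp only [ENNReal.toReal_ofNat] at h6
  rw [← ENNReal.ofReal_toReal hfin]
  exact ENNReal.ofReal_le_ofReal (by linarith)

end MarkovPair
end CuntzMarkov

/-! ### Convergence of the Hellinger series and finiteness of `Z_∞` -/

namespace CuntzMarkov
namespace MarkovPair

variable {N : ℕ} {D D' : MarkovPair N}

/-- Each squared factor cancels one factor of the likelihood ratio. Growth of the ratio after `m`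
thus appears as a drop of the product of square roots. -/
lemma prod_sqrtRatio_sq_mul_likelihood {m n : ℕ} (hmn : m ≤ n) (x : Words N) :
    (∏ k ∈ Finset.Ico m n, D.sqrtRatio D' k (x k) (x (k + 1))) ^ 2 * D.likelihood D' n x =
      D.likelihood D' m x := by
  have h1 : ∀ k, D.sqrtRatio D' k (x k) (x (k + 1)) ^ 2 *
      (D'.trans k (x k) (x (k + 1)) / D.trans k (x k) (x (k + 1))) = 1 := fun k => by
    have h2 := (D.trans_pos k (x k) (x (k + 1))).ne'
    have h3 := (D'.trans_pos k (x k) (x (k + 1))).ne'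
    rw [sqrtRatio_sq]
    field_simp
  rw [likelihood, likelihood, ← Finset.prod_range_mul_prod_Ico _ hmn, ← Finset.prod_pow]
  rw [mul_left_comm, mul_left_comm (∏ k ∈ Finset.Ico m n, _), ← Finset.prod_mul_distrib,
    Finset.prod_congr rfl fun k _ => h1 k, Finset.prod_const_one, mul_one]

/-- The words with small Hellinger sum from the index `m` on for which the square root of the
inverse likelihood ratio drops below one half of its value at `m`, at the latest at the index
`n`. -/
def dropSet (D D' : MarkovPair N) (m : ℕ) (ε : ℝ) (n : ℕ) : Set (Words N) :=
  {x | (∀ k, ∑ i ∈ Finset.Ico m k, D.hellingerTerm D' x i ≤ ε) ∧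
    ∃ l, m ≤ l ∧ l ≤ n ∧ ∏ i ∈ Finset.Ico m l, D.sqrtRatio D' i (x i) (x (i + 1)) < 1 / 2}

open scoped Classical in
lemma measure_dropSet_le (m : ℕ) {ε : ℝ} (hε0 : 0 ≤ ε) (hε : ε ≤ 1) (n : ℕ) :
    D'.measure (D.dropSet D' m ε n) ≤ ENNReal.ofReal (8 * ε) := by
  -- Factors are switched on from `m` until the Hellinger sum exceeds `ε` or the product has dropped
  -- below one half. The Hellinger sum may include the term `k`, which depends only on letter `k`,
  -- so the condition is predictable.
  set C : ℕ → Words N → Prop := fun k x => m ≤ k ∧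
    ∑ i ∈ Finset.Ico m (k + 1), D.hellingerTerm D' x i ≤ ε ∧
    ∀ l ≤ k, m ≤ l → 1 / 2 ≤ ∏ i ∈ Finset.Ico m l, D.sqrtRatio D' i (x i) (x (i + 1)) with hCdef
  have hC : ∀ k, DependsOn (C k) (Set.Iic k) := by
    intro k x y hxy
    have h1 : ∑ i ∈ Finset.Ico m (k + 1), D.hellingerTerm D' x i =
        ∑ i ∈ Finset.Ico m (k + 1), D.hellingerTerm D' y i := by
      refine Finset.sum_congr rfl fun i hi => ?_
      rw [hellingerTerm_eq, hellingerTerm_eq, hxy i (Nat.lt_succ_iff.1 (Finset.mem_Ico.1 hi).2)]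
    have h2 : ∀ l ≤ k, ∏ i ∈ Finset.Ico m l, D.sqrtRatio D' i (x i) (x (i + 1)) =
        ∏ i ∈ Finset.Ico m l, D.sqrtRatio D' i (y i) (y (i + 1)) := by
      intro l hl
      refine Finset.prod_congr rfl fun i hi => ?_
      have hi' := (Finset.mem_Ico.1 hi).2
      rw [hxy i (Set.mem_Iic.2 (by omega)), hxy (i + 1) (Set.mem_Iic.2 (by omega))]
    simp only [hCdef, h1]
    refine propext (and_congr_right fun _ => and_congr_right fun _ => ?_)
    exact forall_congr' fun l => forall_congr' fun hl => by rw [h2 l hl]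
  refine (measure_mono ?_).trans (measure_prod_lt_half_le (D := D) C hC (n := n) hε ?_)
  · rintro x ⟨hx, l, hml, hln, hl⟩
    have hex : ∃ l, m ≤ l ∧ ∏ i ∈ Finset.Ico m l, D.sqrtRatio D' i (x i) (x (i + 1)) < 1 / 2 :=
      ⟨l, hml, hl⟩
    have hfind := Nat.find_spec hex
    have hle : Nat.find hex ≤ n := (Nat.find_min' hex ⟨hml, hl⟩).trans hln
    -- On the drop set the Hellinger bound never intervenes, so the stopped product is the product
    -- up to the first drop.
    have h1 : ∀ k, C k x ↔ m ≤ k ∧ k < Nat.find hex := by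
      intro k
      refine and_congr_right fun _ => ?_
      constructor
      · rintro ⟨-, h2⟩
        by_contra h3
        exact absurd (h2 _ (not_lt.1 h3) hfind.1) (not_le.2 hfind.2)
      · intro h2
        refine ⟨hx _, fun i hi hmi => ?_⟩
        by_contra h3
        exact Nat.find_min hex (hi.trans_lt h2) ⟨hmi, not_le.1 h3⟩
    have h2 : (Finset.range n).filter (fun k => C k x) = Finset.Ico m (Nat.find hex) := by
      ext k
      rw [Finset.mem_filter, h1, Finset.mem_range, Finset.mem_Ico]
      exact ⟨fun h => h.2, fun h => ⟨h.2.trans_le hle, h⟩⟩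
    have h3 := Finset.prod_filter (s := Finset.range n) (fun k => C k x)
      fun k => D.sqrtRatio D' k (x k) (x (k + 1))
    rw [h2] at h3
    rw [Set.mem_ofPred_eq]
    refine lt_of_eq_of_lt (Eq.trans ?_ h3.symm) hfind.2
    exact Finset.prod_congr rfl fun k _ => by congr
  · intro x
    -- The last active index bounds the stopped sum: there the full sum including that term is still
    -- at most `ε`, and later terms are switched off.
    induction n with
    | zero => simpa using hε0
    | succ n ih =>
      by_cases hn : C n x
      · refine le_trans ?_ hn.2.1
        have h3 : Finset.Ico m (n + 1) = (Finset.range (n + 1)).filter (fun k => m ≤ k) := by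
          ext k
          rw [Finset.mem_filter, Finset.mem_range, Finset.mem_Ico, and_comm]
        rw [h3, Finset.sum_filter]
        refine Finset.sum_le_sum fun k _ => ?_
        split_ifs with h4 h5 h5
        · exact le_rfl
        · exact absurd h4.1 h5
        · exact hellingerTerm_nonneg _ _
        · exact le_rfl
      · rw [Finset.sum_range_succ, if_neg hn, add_zero]
        exact ih

/-- A word with small Hellinger sum and infinite `Z_∞` belongs to the drop sets. -/
lemma mem_iUnion_dropSet {m : ℕ} {ε : ℝ} {x : Words N}
    (hx : ∀ k, ∑ i ∈ Finset.Ico m k, D.hellingerTerm D' x i ≤ ε)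
    (htop : D.limsupRatio D' x = ∞) : x ∈ ⋃ n, D.dropSet D' m ε n := by
  rw [limsupRatio_eq] at htop
  -- The factor 4 is `(1/2)⁻²`: a fourfold growth of the likelihood ratio pushes the product below
  -- one half.
  have h1 : ∃ᶠ n in atTop, ENNReal.ofReal (4 * D.likelihood D' m x) <
      ENNReal.ofReal (D.likelihood D' n x) :=
    frequently_lt_of_lt_limsup (by isBoundedDefault) (by rw [htop]; exact ENNReal.ofReal_lt_top)
  obtain ⟨n, hmn, hn⟩ := frequently_atTop.1 h1 m
  have hn' := (ENNReal.ofReal_lt_ofReal_iff (likelihood_pos n x)).1 hn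
  refine Set.mem_iUnion.2 ⟨n, hx, n, hmn, le_rfl, ?_⟩
  have h2 := prod_sqrtRatio_sq_mul_likelihood (D := D) (D' := D') hmn x
  by_contra h3
  have h4 : (1 / 2 : ℝ) ^ 2 ≤
      (∏ k ∈ Finset.Ico m n, D.sqrtRatio D' k (x k) (x (k + 1))) ^ 2 :=
    pow_le_pow_left₀ (by norm_num) (not_lt.1 h3) 2
  nlinarith [likelihood_pos (D := D) (D' := D') n x]

/-- A convergent series has some tail with sum at most `ε`, so such words lie in the increasing
union of the sets `H m`. Each `H m` lies in an increasing union of drop sets of measure at most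
`8ε`, and `ε` is arbitrary. -/
lemma measure_summable_inter_eq_top_eq_zero :
    D'.measure {x | Summable (D.hellingerTerm D' x) ∧ D.limsupRatio D' x = ∞} = 0 := by
  have hbound : ∀ ε : ℝ, 0 < ε → ε ≤ 1 →
      D'.measure {x | Summable (D.hellingerTerm D' x) ∧ D.limsupRatio D' x = ∞} ≤
        ENNReal.ofReal (8 * ε) := by
    intro ε hε hε1
    set H : ℕ → Set (Words N) := fun m =>
      {x | (∀ k, ∑ i ∈ Finset.Ico m k, D.hellingerTerm D' x i ≤ ε) ∧ D.limsupRatio D' x = ∞}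
    have hH : Monotone H := by
      intro m m' hm x hx
      refine ⟨fun k => le_trans ?_ (hx.1 k), hx.2⟩
      exact Finset.sum_le_sum_of_subset_of_nonneg (Finset.Ico_subset_Ico_left hm)
        fun i _ _ => hellingerTerm_nonneg _ _
    have hsub : {x | Summable (D.hellingerTerm D' x) ∧ D.limsupRatio D' x = ∞} ⊆ ⋃ m, H m := by
      rintro x ⟨hx, htop⟩
      have h1 := hx.hasSum.tendsto_sum_nat
      have h2 : ∀ᶠ m in atTop, ∑' i, D.hellingerTerm D' x i - ε <
          ∑ i ∈ Finset.range m, D.hellingerTerm D' x i :=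
        h1.eventually (lt_mem_nhds (by linarith))
      obtain ⟨m, hm⟩ := h2.exists
      refine Set.mem_iUnion.2 ⟨m, fun k => ?_, htop⟩
      rcases le_total m k with hmk | hmk
      · have h3 := hx.sum_le_tsum (Finset.range k) fun i _ => hellingerTerm_nonneg x i
        rw [← Finset.sum_range_add_sum_Ico _ hmk] at h3
        linarith
      · rw [Finset.Ico_eq_empty_of_le hmk, Finset.sum_empty]
        exact hε.le
    refine (measure_mono hsub).trans ?_
    rw [hH.measure_iUnion]
    refine iSup_le fun m => ?_
    have hmono : Monotone fun n => D.dropSet D' m ε n := by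
      rintro n n' hn x ⟨hx, l, hml, hln, hl⟩
      exact ⟨hx, l, hml, hln.trans hn, hl⟩
    refine (measure_mono fun x hx => mem_iUnion_dropSet hx.1 hx.2).trans ?_
    rw [hmono.measure_iUnion]
    exact iSup_le fun n => measure_dropSet_le m hε.le hε1 n
  have hlim : Tendsto (fun n : ℕ => ENNReal.ofReal (8 * (1 / ((n : ℝ) + 1)))) atTop (𝓝 0) := by
    have h1 := (tendsto_one_div_add_atTop_nhds_zero_nat (𝕜 := ℝ)).const_mul 8
    rw [mul_zero] at h1
    simpa using ENNReal.tendsto_ofReal h1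
  refine nonpos_iff_eq_zero.1 (ge_of_tendsto' hlim fun n => hbound _ (by positivity) ?_)
  rw [div_le_one (by positivity)]
  linarith [(Nat.cast_nonneg n : (0 : ℝ) ≤ n)]

lemma tendsto_prod_affinity {x : Words N} (hx : ¬ Summable (D.hellingerTerm D' x)) :
    Tendsto (fun n => ∏ k ∈ Finset.range n, D.affinity D' k (x k)) atTop (𝓝 0) := by
  have h1 := (not_summable_iff_tendsto_nat_atTop_of_nonneg (hellingerTerm_nonneg x)).1 hx
  refine squeeze_zero (fun n => Finset.prod_nonneg fun k _ => (affinity_pos _ _).le)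
    (fun n => ?_) (Real.tendsto_exp_neg_atTop_nhds_zero.comp h1)
  rw [Function.comp_apply, ← Finset.sum_neg_distrib, Real.exp_sum]
  refine Finset.prod_le_prod (fun k _ => (affinity_pos _ _).le) fun k _ => ?_
  -- Each affinity `1 - t` is at most `exp (-t)`, so a divergent sum sends the product to zero.
  have h2 := Real.add_one_le_exp (-D.hellingerTerm D' x k)
  rw [hellingerTerm_eq] at h2 ⊢
  linarith

/-- The normalized products `M n` have mean 1, so Fatou bounds their liminf almost everywhere. If
`Zₙ` were eventually bounded, the unnormalized products would stay away from 0, and dividing by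
affinity products tending to 0 would send `M n` to infinity. -/
lemma ae_eq_top_of_not_summable :
    ∀ᵐ x ∂D'.measure, ¬ Summable (D.hellingerTerm D' x) → D.limsupRatio D' x = ∞ := by
  set M : ℕ → Words N → ℝ≥0∞ := fun n x => ∏ k ∈ Finset.range n,
    ENNReal.ofReal (D.sqrtRatio D' k (x k) (x (k + 1)) / D.affinity D' k (x k)) with hM
  have hMm : ∀ n, Measurable (M n) := fun n => Finset.measurable_prod _ fun k _ =>
    measurable_of_letters (fun i j => ENNReal.ofReal (D.sqrtRatio D' k i j / D.affinity D' k i))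
      k (k + 1)
  have hint : ∀ n, ∫⁻ x, M n x ∂D'.measure = 1 := fun n => by
    have h1 := lintegral_prod_predictable D'
      (fun k i j => ENNReal.ofReal (D.sqrtRatio D' k i j / D.affinity D' k i))
      sum_mul_sqrtRatio_div (fun _ _ => True) (fun _ _ _ _ => rfl) n
    simpa using h1
  have hfatou : ∫⁻ x, liminf (fun n => M n x) atTop ∂D'.measure ≤ 1 := by
    refine (lintegral_liminf_le hMm).trans ?_
    simp [hint]
  filter_upwards [ae_lt_top (Measurable.liminf hMm) (hfatou.trans_lt ENNReal.one_lt_top).ne]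
    with x hx hns
  by_contra htop
  rw [limsupRatio_eq] at htop
  obtain ⟨K, hK⟩ := ENNReal.lt_iff_exists_nnreal_btwn.1 (lt_top_iff_ne_top.2 htop)
  have h1 : ∀ᶠ n in atTop, ENNReal.ofReal (D.likelihood D' n x) < K :=
    eventually_lt_of_limsup_lt hK.1
  have hL0 := likelihood_pos (D := D) (D' := D') 0 x
  have hK0 : 0 < (K : ℝ) := by
    have h2 := zero_le.trans_lt hK.1
    exact_mod_cast h2
  -- The squared product times `Zₙ` equals `Z₀`, so `Zₙ ≤ K` bounds the product below by `√(Z₀ /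
  -- K)`.
  set c : ℝ := √(D.likelihood D' 0 x / K) with hc
  have hc0 : 0 < c := Real.sqrt_pos.2 (div_pos hL0 hK0)
  have h2 : Tendsto (fun n => c * (∏ k ∈ Finset.range n, D.affinity D' k (x k))⁻¹) atTop atTop := by
    refine Tendsto.const_mul_atTop hc0 (tendsto_inv_nhdsGT_zero.comp ?_)
    exact tendsto_nhdsWithin_iff.2 ⟨tendsto_prod_affinity hns, Eventually.of_forall fun n =>
      Finset.prod_pos fun k _ => affinity_pos _ _⟩
  have h3 : Tendsto (fun n => M n x) atTop (𝓝 ∞) := by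
    refine tendsto_nhds_top_mono (ENNReal.tendsto_ofReal_atTop.comp h2) ?_
    filter_upwards [h1] with n hn
    have hn' : D.likelihood D' n x ≤ K := by
      rw [← ENNReal.ofReal_coe_nnreal] at hn
      exact ((ENNReal.ofReal_lt_ofReal_iff hK0).1 hn).le
    have h4 := prod_sqrtRatio_sq_mul_likelihood (D := D) (D' := D') (Nat.zero_le n) x
    rw [← Finset.range_eq_Ico] at h4
    have hP0 : 0 ≤ ∏ k ∈ Finset.range n, D.sqrtRatio D' k (x k) (x (k + 1)) :=
      Finset.prod_nonneg fun k _ => (sqrtRatio_pos _ _ _).le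
    have h5 : c ≤ ∏ k ∈ Finset.range n, D.sqrtRatio D' k (x k) (x (k + 1)) := by
      rw [hc, Real.sqrt_le_left hP0, div_le_iff₀ hK0, ← h4]
      exact mul_le_mul_of_nonneg_left hn' (sq_nonneg _)
    rw [Function.comp_apply, hM]
    dsimp only
    rw [← ENNReal.ofReal_prod_of_nonneg fun k _ =>
      div_nonneg (sqrtRatio_pos _ _ _).le (affinity_pos _ _).le, Finset.prod_div_distrib,
      div_eq_mul_inv]
    exact ENNReal.ofReal_le_ofReal (mul_le_mul_of_nonneg_right h5
      (inv_nonneg.2 (Finset.prod_nonneg fun k _ => (affinity_pos _ _).le)))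
  rw [h3.liminf_eq] at hx
  exact lt_irrefl _ hx

/-- The Hellinger series converges exactly where `Z_∞` is finite, up to a `μ'`-null set. -/
lemma ae_summable_iff_lt_top :
    ∀ᵐ x ∂D'.measure, Summable (D.hellingerTerm D' x) ↔ D.limsupRatio D' x < ∞ := by
  filter_upwards [ae_eq_top_of_not_summable (D := D) (D' := D'), measure_eq_zero_iff_ae_notMem.1
    (measure_summable_inter_eq_top_eq_zero (D := D) (D' := D'))] with x h1 h2
  constructor
  · intro h3
    exact lt_top_iff_ne_top.2 fun h4 => h2 ⟨h3, h4⟩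
  · intro h3
    by_contra h4
    exact h3.ne (h1 h4)

lemma absolutelyContinuous_iff_ae_summable :
    D'.measure ≪ D.measure ↔ ∀ᵐ x ∂D'.measure, Summable (D.hellingerTerm D' x) := by
  rw [absolutelyContinuous_iff_ae_lt_top]
  exact eventually_congr ((ae_summable_iff_lt_top (D := D) (D' := D')).mono fun x hx => hx.symm)

lemma mutuallySingular_iff_ae_tendsto :
    D.measure ⟂ₘ D'.measure ↔ ∀ᵐ x ∂D'.measure,
      Tendsto (fun m => ∑ n ∈ Finset.range m, D.hellingerTerm D' x n) atTop atTop := by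
  rw [mutuallySingular_iff_ae_eq_top]
  refine eventually_congr ((ae_summable_iff_lt_top (D := D) (D' := D')).mono fun x hx => ?_)
  rw [← not_summable_iff_tendsto_nat_atTop_of_nonneg (hellingerTerm_nonneg x), hx, not_lt,
    top_le_iff]

end MarkovPair
end CuntzMarkov

/-! ### The two chains of equivalences -/

theorem proposition4p2 {N : ℕ} (hN : 2 ≤ N) (D D' : CuntzMarkov.MarkovPair N)
    (h : D.IsQuasiStationary) (h' : D'.IsQuasiStationary) :
    List.TFAE [
      (CuntzMarkov.MarkovPair.cuntzRep h).Equivalent (CuntzMarkov.MarkovPair.cuntzRep h'),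
      D.measure ≪ D'.measure ∧ D'.measure ≪ D.measure,
      D'.measure {x | D.limsupRatio D' x < ∞} = 1 ∧ D.measure {x | 0 < D.limsupRatio D' x} = 1,
      (∀ᵐ x ∂D.measure, Summable (D.hellingerTerm D' x)) ∧
        (∀ᵐ x ∂D'.measure, Summable (D.hellingerTerm D' x))] ∧
    List.TFAE [
      (CuntzMarkov.MarkovPair.cuntzRep h).Disjoint (CuntzMarkov.MarkovPair.cuntzRep h'),
      D.measure ⟂ₘ D'.measure,
      D'.measure {x | D.limsupRatio D' x = ∞} = 1 ∨ D.measure {x | D.limsupRatio D' x = 0} = 1,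
      ∀ᵐ x ∂D'.measure, Tendsto (fun m => ∑ n ∈ Finset.range m, D.hellingerTerm D' x n)
        atTop atTop] := by
  have hZ := CuntzMarkov.MarkovPair.measurable_limsupRatio D D'
  constructor
  · tfae_have 1 ↔ 2 :=
      ⟨fun he => ⟨CuntzMarkov.MarkovPair.absolutelyContinuous_of_equivalent h h' he,
        CuntzMarkov.MarkovPair.absolutelyContinuous_of_equivalent h' h he.symm⟩,
        fun hm => CuntzMarkov.MarkovPair.equivalent_of_absolutelyContinuous h h' hm.1 hm.2⟩
    tfae_have 2 ↔ 3 := by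
      rw [CuntzMarkov.MarkovPair.absolutelyContinuous_iff_ae_pos,
        CuntzMarkov.MarkovPair.absolutelyContinuous_iff_ae_lt_top, and_comm]
      exact and_congr (mem_ae_iff_prob_eq_one (hZ measurableSet_Iio))
        (mem_ae_iff_prob_eq_one (hZ measurableSet_Ioi))
    -- The one-sided criterion is used in both directions; the Hellinger terms are symmetric in the
    -- two measures.
    tfae_have 2 ↔ 4 := by
      rw [CuntzMarkov.MarkovPair.absolutelyContinuous_iff_ae_summable (D := D) (D' := D'),
        CuntzMarkov.MarkovPair.absolutelyContinuous_iff_ae_summable (D := D') (D' := D),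
        CuntzMarkov.MarkovPair.hellingerTerm_comm D' D]
    tfae_finish
  · tfae_have 1 ↔ 2 := ⟨CuntzMarkov.MarkovPair.mutuallySingular_of_disjoint h h',
      CuntzMarkov.MarkovPair.disjoint_of_mutuallySingular h h'⟩
    tfae_have 2 ↔ 3 := by
      -- Each alternative is by itself equivalent to singularity, so singularity is doubled to match
      -- the disjunction.
      rw [← or_self (D.measure ⟂ₘ D'.measure)]
      exact or_congr (CuntzMarkov.MarkovPair.mutuallySingular_iff_ae_eq_top.trans
          (mem_ae_iff_prob_eq_one (hZ (measurableSet_singleton _))))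
        (CuntzMarkov.MarkovPair.mutuallySingular_iff_ae_eq_zero.trans
          (mem_ae_iff_prob_eq_one (hZ (measurableSet_singleton _))))
    tfae_have 2 ↔ 4 := CuntzMarkov.MarkovPair.mutuallySingular_iff_ae_tendsto
    tfae_finish
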